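/- Let $\sigma_\star>0$, $\lambda>\sigma_\star/2$, $\beta>0$, $\rho\in[0,1]$. Let $\mu_D$ be the semicircle law on $[-\sigma_\star,\sigma_\star]$, with density $\frac{2}{\pi\sigma_\star^2}\sqrt{\sigma_\star^2-x^2}$, and let $\mathcal S(z)=\mathbb E_{\sigma\sim\mu_D}[\frac1{z-\sigma}]$ for $z\in\mathbb R\setminus[-\sigma_\star,\sigma_\star]$. Let $(u,Y_0)$ be a pair of real random variables with $u\sim\mathcal N(0,\lambda)$, $\mathbb E[Y_0^2]=1$, $\mathbb E[Y_0u]=\rho\sqrt\lambda$, and let $\sigma\sim\mu_D$ be independent of $(u,Y_0)$. Let $f(x)=x^2/2$, and for a function $K$ on $[0,\infty)^2$ write $e_K(r,t)=\exp\{-\int_r^t f'(K(w,w))\,dw\}$. Consider the following system for continuous $R:[0,\infty)\to\mathbb R$ and $K:[0,\infty)^2\to\mathbb R$, where $t,s\ge 0$: $$R(t)=e_K(0,t)\,\mathbb E[e^{\sigma t}Y_0u]+\int_0^t e_K(s,t)R(s)\,\mathbb E[e^{\sigma(t-s)}u^2]\,ds,$$ $$\begin{aligned}K(t,s)={}&\beta^{-1}\int_0^{s\wedge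 t}e_K(r,t)e_K(r,s)\,\mathbb E[e^{\sigma(t+s-2r)}]\,dr+e_K(0,t)e_K(0,s)\,\mathbb E[e^{\sigma(t+s)}Y_0^2]\\&+e_K(0,t)\int_0^s e_K(r,s)R(r)\,\mathbb E[e^{\sigma(t+s-r)}Y_0u]\,dr+e_K(0,s)\int_0^t e_K(r,t)R(r)\,\mathbb E[e^{\sigma(t+s-r)}Y_0u]\,dr\\&+\int_0^t\int_0^s e_K(r_1,t)e_K(r_2,s)R(r_1)R(r_2)\,\mathbb E[e^{\sigma(t+s-r_1-r_2)}u^2]\,dr_2\,dr_1.\end{aligned}$$ This system has a unique continuous solution $(R,K)$, and $K(t,t)>0$ for all $t\ge0$. Put $\tilde\lambda=\lambda+\frac{\sigma_\star^2}{4\lambda}$. The equation $z=\beta^{-1}\mathcal S(z/2)$, in real $z$ with $z/2\notin[-\sigma_\star,\sigma_\star]$, has a root if and only if $\beta<1/\sigma_\star^2$, and then it has exactly two real roots. Let $s_\beta$ be the largest real root if $\beta<1/\sigma_\star^2$, and $s_\beta=2\sigma_\star$ otherwise. (i) If $2\tilde\lambda<s_\beta$ or $\rho=0$, then $\lim_{t\to\infty}\frac{R(t)^2}{\lambda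 K(t,t)}=0$. (ii) If $2\tilde\lambda>s_\beta$ and $\rho>0$, then $$\lim_{t\to\infty}\frac{R(t)^2}{\lambda K(t,t)}=\Big(1-\frac{\beta^{-1}}{2\lambda(\lambda+\sigma_\star^2/(4\lambda))}\Big)\Big(1-\frac{\sigma_\star^2}{4\lambda^2}\Big).$$ -/

import Mathlib

open MeasureTheory ProbabilityTheory Filter Topology

noncomputable section

namespace CHSCK

/-- The semicircle law on `[-σ, σ]`, with density `2 / (π σ²) √(σ² - x²)`; the density vanishes
outside `[-σ, σ]` because the real square root of a negative number is `0`. -/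
def semicircle (σ : ℝ) : Measure ℝ :=
  volume.withDensity fun x => ENNReal.ofReal (2 / (Real.pi * σ ^ 2) * √(σ ^ 2 - x ^ 2))

/-- The Stieltjes transform `S(z) = E_{x ∼ μ} [1 / (z - x)]`, used only for `z` outside the
support of `μ`. -/
def stieltjes (μ : Measure ℝ) (z : ℝ) : ℝ := ∫ x, 1 / (z - x) ∂μ

/-- The real roots of `z = β⁻¹ S(z / 2)`, where `S : ℝ ∖ [-σ, σ] → ℝ` is the Stieltjes transform of
the semicircle law on `[-σ, σ]`. -/
def roots (β σ : ℝ) : Set ℝ :=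
  {z | z / 2 ∉ Set.Icc (-σ) σ ∧ z = β⁻¹ * stieltjes (semicircle σ) (z / 2)}

open Classical in
/-- The threshold `s_β`: the largest real root if `β < 1 / σ²`, and `2 σ` otherwise. -/
def threshold (β σ : ℝ) : ℝ := if β < 1 / σ ^ 2 then sSup (roots β σ) else 2 * σ

/-- The possible laws `ν` of the pair `(u, Y₀)`: `u ∼ N(0, lam)`, `E[Y₀²] = 1` and
`E[Y₀ u] = ρ √lam`. Both the law of `Y₀` and its dependence on `u` are otherwise free. -/
structure IsInitialLaw (lam ρ : ℝ) (ν : Measure (ℝ × ℝ)) : Prop where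
  isProbabilityMeasure : IsProbabilityMeasure ν
  map_fst : ν.map Prod.fst = gaussianReal 0 lam.toNNReal
  sq_snd : ∫ p, p.2 ^ 2 ∂ν = 1
  snd_mul_fst : ∫ p, p.2 * p.1 ∂ν = ρ * √lam

/-- The law `π^∞` of `((u, Y₀), σ)`: the pair `(u, Y₀) ∼ ν` is independent of `σ ∼ μ`. -/
def limitLaw (ν : Measure (ℝ × ℝ)) (μ : Measure ℝ) : Measure ((ℝ × ℝ) × ℝ) := ν.prod μ

/-- `decay f K r t = exp (-∫_r^t f'(K(w)) dw)`, where `K(w) = K(w, w)`. -/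
def decay (f : ℝ → ℝ) (K : ℝ → ℝ → ℝ) (r t : ℝ) : ℝ :=
  Real.exp (-∫ w in r..t, deriv f (K w w))

/-- `(R, K)` is a continuous solution, on `[0, ∞)` and `[0, ∞)²`, of the limiting
(Crisanti–Horner–Sommers–Cugliandolo–Kurchan) system with confining potential `f`, inverse
temperature `β` and law `P` of `((u, Y₀), σ)`: in the integrals over `P`, `p.1.1` is `u`, `p.1.2` is
`Y₀` and `p.2` is `σ`. -/
structure IsSolution (f : ℝ → ℝ) (β : ℝ) (P : Measure ((ℝ × ℝ) × ℝ))
    (R : ℝ → ℝ) (K : ℝ → ℝ → ℝ) : Prop where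
  continuousOn_R : ContinuousOn R (Set.Ici 0)
  continuousOn_K : ContinuousOn (fun q : ℝ × ℝ => K q.1 q.2) (Set.Ici 0 ×ˢ Set.Ici 0)
  eq_R : ∀ t : ℝ, 0 ≤ t →
    R t = decay f K 0 t * (∫ p, Real.exp (p.2 * t) * p.1.2 * p.1.1 ∂P)
      + ∫ s in (0 : ℝ)..t,
          decay f K s t * R s * (∫ p, Real.exp (p.2 * (t - s)) * p.1.1 ^ 2 ∂P)
  eq_K : ∀ t s : ℝ, 0 ≤ t → 0 ≤ s →
    K t s =
      β⁻¹ * (∫ r in (0 : ℝ)..(min s t),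
          decay f K r t * decay f K r s * (∫ p, Real.exp (p.2 * (t + s - 2 * r)) ∂P))
      + decay f K 0 t * decay f K 0 s * (∫ p, Real.exp (p.2 * (t + s)) * p.1.2 ^ 2 ∂P)
      + decay f K 0 t * (∫ r in (0 : ℝ)..s,
          decay f K r s * R r * (∫ p, Real.exp (p.2 * (t + s - r)) * p.1.2 * p.1.1 ∂P))
      + decay f K 0 s * (∫ r in (0 : ℝ)..t,
          decay f K r t * R r * (∫ p, Real.exp (p.2 * (t + s - r)) * p.1.2 * p.1.1 ∂P))
      + ∫ r₁ in (0 : ℝ)..t, ∫ r₂ in (0 : ℝ)..s,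
          decay f K r₁ t * decay f K r₂ s * R r₁ * R r₂ *
            (∫ p, Real.exp (p.2 * (t + s - r₁ - r₂)) * p.1.1 ^ 2 ∂P)

end CHSCK

end

/-! The nonlinear system becomes linear once the decay is factored out. Put `g(t) = e_K(0,t)`, so
that `e_K(r,t) = g(t)/g(r)`, and let `m` be the moment generating function of the semicircle law.
Then `R/g` solves `x = ρ√λ m + λ m ∗ x`, hence `R = ρ√λ h g`, where `h = m + λ m ∗ h` is the
`spikeResponse`. Every term of `K(t,s)` carries the factor `g(t) g(s)`. On the diagonal, the terms
containing `R` collapse by `response_double`. Heuristically, `h(t) = ⟨u, e^{tJ} u⟩` for `J = A + λ u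
uᵀ`, and the squared norm of Duhamel's formula for `e^{tJ} u` is `h(2t)`.

With `p(2t) = K(t,t)/g(t)²`, the function `Y(2t) = g(t)⁻²` satisfies `Y' = p`, and the diagonal
equation becomes the linear Volterra equation of `IsEnergy`, with kernel `(b/2) (1 ∗ m)` and `b =
β⁻¹`. This equation has exactly one solution on the half-line, which gives existence and uniqueness
for the system. The decay cancels in the overlap: `R²/(λK) = ρ² h(t)²/p(2t)` (`overlap_eq`).

It remains to compare growth rates. The Laplace transform of `m` is the Stieltjes transform `S`, and
`σ²S²/4 - zS + 1 = 0`. This gives `h` in closed form, with `h(t) ~ (1 - σ²/(4λ²)) exp(λ̃ t)` and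
`S(λ̃) = 1/λ`. At rate `z` the kernel has weighted mass `b S(z)/(2z)`, so `z = s_β/2` is the rate at
which the mass is `1` when a root exists. If `2λ̃ > s_β`, the mass at `λ̃` is `b/(2λλ̃) < 1`, and
the limit of `exp(-λ̃ t) p(t)` follows from a contraction argument (`volterra_exists_exp`); the
quotient of the two limits is the stated value. If `2λ̃ < s_β`, the noise alone makes `p` grow at
least at rate `s_β/2` (`exists_resolvent`, `IsEnergy.le`), which exceeds `λ̃`, and the overlap
vanishes. -/

namespace CHSCK

/-! ### Algebra of convolution on the half-line. -/

/-- Convolution of functions on the half-line: `(f ∗ g)(t) = ∫₀ᵗ f(x) g(t - x) dx`. -/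
noncomputable def vconv (f g : ℝ → ℝ) (t : ℝ) : ℝ := ∫ x in (0 : ℝ)..t, f x * g (t - x)

theorem vconv_comm (f g : ℝ → ℝ) (t : ℝ) : vconv f g t = vconv g f t := by
  unfold vconv
  have := intervalIntegral.integral_comp_sub_left (a := 0) (b := t) (fun x => g x * f (t - x)) t
  simp only [sub_self, sub_zero, sub_sub_cancel] at this
  rw [← this]
  exact intervalIntegral.integral_congr fun x _ => mul_comm _ _

@[fun_prop]
theorem continuous_vconv {f g : ℝ → ℝ} (hf : Continuous f) (hg : Continuous g) :
    Continuous (vconv f g) := by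
  unfold vconv
  exact intervalIntegral.continuous_parametric_intervalIntegral_of_continuous
    (f := fun t x => f x * g (t - x)) (by fun_prop) continuous_id

theorem vconv_congr {f g f' g' : ℝ → ℝ} {t : ℝ} (ht : 0 ≤ t)
    (hf : ∀ x, 0 ≤ x → x ≤ t → f x = f' x) (hg : ∀ x, 0 ≤ x → x ≤ t → g x = g' x) :
    vconv f g t = vconv f' g' t := by
  unfold vconv
  refine intervalIntegral.integral_congr fun x hx => ?_
  rw [Set.uIcc_of_le ht] at hx
  simp only [hf x hx.1 hx.2, hg (t - x) (by linarith [hx.2]) (by linarith [hx.1])]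

theorem vconv_nonneg {f g : ℝ → ℝ} {t : ℝ} (ht : 0 ≤ t) (hf : ∀ x, 0 ≤ x → x ≤ t → 0 ≤ f x)
    (hg : ∀ x, 0 ≤ x → x ≤ t → 0 ≤ g x) : 0 ≤ vconv f g t :=
  intervalIntegral.integral_nonneg ht fun x hx =>
    mul_nonneg (hf x hx.1 hx.2) (hg _ (by linarith [hx.2]) (by linarith [hx.1]))

theorem vconv_add_right {f g k : ℝ → ℝ} (hf : Continuous f) (hg : Continuous g)
    (hk : Continuous k) (t : ℝ) :
    vconv f (fun x => g x + k x) t = vconv f g t + vconv f k t := by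
  unfold vconv
  rw [← intervalIntegral.integral_add]
  · exact intervalIntegral.integral_congr fun x _ => by ring
  · exact Continuous.intervalIntegrable (by fun_prop) _ _
  · exact Continuous.intervalIntegrable (by fun_prop) _ _

theorem vconv_sub_right {f g k : ℝ → ℝ} (hf : Continuous f) (hg : Continuous g)
    (hk : Continuous k) (t : ℝ) :
    vconv f (fun x => g x - k x) t = vconv f g t - vconv f k t := by
  unfold vconv
  rw [← intervalIntegral.integral_sub]
  · exact intervalIntegral.integral_congr fun x _ => by ring
  · exact Continuous.intervalIntegrable (by fun_prop) _ _
  · exact Continuous.intervalIntegrable (by fun_prop) _ _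

theorem vconv_const_mul_right (f g : ℝ → ℝ) (c t : ℝ) :
    vconv f (fun x => c * g x) t = c * vconv f g t := by
  unfold vconv
  rw [← intervalIntegral.integral_const_mul]
  exact intervalIntegral.integral_congr fun x _ => by ring

theorem vconv_const_mul_left (f g : ℝ → ℝ) (c t : ℝ) :
    vconv (fun x => c * f x) g t = c * vconv f g t := by
  rw [vconv_comm, vconv_const_mul_right, vconv_comm]

theorem vconv_one_left (f : ℝ → ℝ) (t : ℝ) : vconv (fun _ => 1) f t = ∫ x in (0 : ℝ)..t, f x := by
  rw [vconv_comm]; simp [vconv]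

theorem exp_mul_vconv (f g : ℝ → ℝ) (c t : ℝ) :
    Real.exp (c * t) * vconv f g t =
      vconv (fun x => Real.exp (c * x) * f x) (fun x => Real.exp (c * x) * g x) t := by
  unfold vconv
  rw [← intervalIntegral.integral_const_mul]
  refine intervalIntegral.integral_congr fun x _ => ?_
  have : Real.exp (c * t) = Real.exp (c * x) * Real.exp (c * (t - x)) := by
    rw [← Real.exp_add]; ring_nf
  simp only [this]; ring

/-- Fubini on the square, applied to the integrand cut off by the indicator of the triangle `w ≤ x`.
-/
theorem integral_triangle_swap {φ : ℝ → ℝ → ℝ} (hφ : Continuous (Function.uncurry φ)) {t : ℝ}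
    (ht : 0 ≤ t) :
    ∫ x in (0 : ℝ)..t, ∫ w in (0 : ℝ)..x, φ x w = ∫ w in (0 : ℝ)..t, ∫ x in w..t, φ x w := by
  set F : ℝ → ℝ → ℝ := fun x w => ({p : ℝ × ℝ | p.2 ≤ p.1}).indicator (Function.uncurry φ) (x, w)
  have hms : MeasurableSet {p : ℝ × ℝ | p.2 ≤ p.1} :=
    (isClosed_le continuous_snd continuous_fst).measurableSet
  have key := intervalIntegral_intervalIntegral_swap (F := F) (a := 0) (b := t) (c := 0) (d := t) (by
    have h1 : IntegrableOn (Function.uncurry φ) (Set.uIcc 0 t ×ˢ Set.uIcc 0 t) :=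
      hφ.continuousOn.integrableOn_compact (isCompact_uIcc.prod isCompact_uIcc)
    exact (h1.indicator hms).mono_set
      (Set.prod_mono Set.uIoc_subset_uIcc Set.uIoc_subset_uIcc))
  have hl : ∀ x ∈ Set.uIcc 0 t, ∫ w in (0 : ℝ)..t, F x w = ∫ w in (0 : ℝ)..x, φ x w := by
    intro x hx
    rw [Set.uIcc_of_le ht] at hx
    rw [intervalIntegral.integral_of_le ht, intervalIntegral.integral_of_le hx.1]
    have : (fun w => F x w) = (Set.Iic x).indicator (φ x) := by
      ext w; simp [F, Set.indicator, Function.uncurry]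
    rw [this, setIntegral_indicator measurableSet_Iic]
    congr 2
    ext w; simp only [Set.mem_inter_iff, Set.mem_Ioc, Set.mem_Iic]
    constructor
    · rintro ⟨h1, h2⟩; exact ⟨h1.1, h2⟩
    · rintro ⟨h1, h2⟩; exact ⟨⟨h1, h2.trans hx.2⟩, h2⟩
  have hr : ∀ w ∈ Set.uIcc 0 t, ∫ x in (0 : ℝ)..t, F x w = ∫ x in w..t, φ x w := by
    intro w hw
    rw [Set.uIcc_of_le ht] at hw
    rw [intervalIntegral.integral_of_le ht, intervalIntegral.integral_of_le hw.2,
      ← integral_Icc_eq_integral_Ioc, ← integral_Icc_eq_integral_Ioc]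
    have : (fun x => F x w) = (Set.Ici w).indicator (fun x => φ x w) := by
      ext x; simp [F, Set.indicator, Function.uncurry]
    rw [this, setIntegral_indicator measurableSet_Ici]
    congr 2
    ext x; simp only [Set.mem_inter_iff, Set.mem_Icc, Set.mem_Ici]
    constructor
    · rintro ⟨h1, h2⟩; exact ⟨h2, h1.2⟩
    · rintro ⟨h1, h2⟩; exact ⟨⟨hw.1.trans h1, h2⟩, h1⟩
  rw [← intervalIntegral.integral_congr hl, ← intervalIntegral.integral_congr hr, key]

theorem vconv_assoc {f g k : ℝ → ℝ} (hf : Continuous f) (hg : Continuous g) (hk : Continuous k)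
    {t : ℝ} (ht : 0 ≤ t) : vconv (vconv f g) k t = vconv f (vconv g k) t := by
  have h1 : vconv (vconv f g) k t =
      ∫ x in (0 : ℝ)..t, ∫ w in (0 : ℝ)..x, f w * g (x - w) * k (t - x) := by
    unfold vconv
    exact intervalIntegral.integral_congr fun x _ => by
      simp only [intervalIntegral.integral_mul_const]
  rw [h1, integral_triangle_swap (φ := fun x w => f w * g (x - w) * k (t - x)) (by fun_prop) ht]
  unfold vconv
  refine intervalIntegral.integral_congr fun w _ => ?_
  have := intervalIntegral.integral_comp_sub_right (a := w) (b := t)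
    (fun x => g x * k (t - w - x)) w
  simp only [sub_self] at this
  simp only [mul_assoc, intervalIntegral.integral_const_mul]
  rw [← this]
  congr 1
  exact intervalIntegral.integral_congr fun x _ => by
    ring_nf

theorem vconv_left_comm {f g k : ℝ → ℝ} (hf : Continuous f) (hg : Continuous g)
    (hk : Continuous k) {t : ℝ} (ht : 0 ≤ t) :
    vconv f (vconv g k) t = vconv g (vconv f k) t := by
  rw [← vconv_assoc hf hg hk ht, ← vconv_assoc hg hf hk ht]
  exact vconv_congr ht (fun x _ _ => vconv_comm f g x) fun _ _ _ => rfl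

/-! ### Linear Volterra equations: uniqueness, positivity, existence and limits. -/

/-- A homogeneous Volterra inequality has only the zero solution. -/
theorem volterra_eq_zero {k D : ℝ → ℝ} (hk : Continuous k) (hD : Continuous D)
    (h : ∀ t, 0 ≤ t → |D t| ≤ |vconv k D t|) : ∀ t, 0 ≤ t → D t = 0 := by
  intro T hT
  obtain ⟨C, hC⟩ := (isCompact_Icc (a := (0 : ℝ)) (b := T)).exists_bound_of_continuousOn
    hk.continuousOn
  have hderiv : ∀ x, HasDerivAt (fun t => ∫ u in (0 : ℝ)..t, |D u|) |D x| x := fun x =>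
    intervalIntegral.integral_hasDerivAt_right (Continuous.intervalIntegrable (by fun_prop) _ _)
      (Continuous.stronglyMeasurableAtFilter (by fun_prop) _ _) (by fun_prop)
  have hbd : ∀ x ∈ Set.Icc 0 T, |D x| ≤ C * ∫ u in (0 : ℝ)..x, |D u| := by
    intro x hx
    refine (h x hx.1).trans ?_
    rw [vconv_comm, ← intervalIntegral.integral_const_mul]
    unfold vconv
    refine (intervalIntegral.abs_integral_le_integral_abs hx.1).trans ?_
    refine intervalIntegral.integral_mono_on hx.1 (Continuous.intervalIntegrable (by fun_prop) _ _)
      (Continuous.intervalIntegrable (by fun_prop) _ _) fun u hu => ?_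
    rw [abs_mul, mul_comm]
    exact mul_le_mul_of_nonneg_right
      (hC (x - u) ⟨by linarith [hu.2], by linarith [hu.1, hx.2]⟩) (abs_nonneg _)
  -- Grönwall for the primitive of `|D|`, whose derivative is at most `C` times itself on `[0, T]`.
  have hz := eq_zero_of_abs_deriv_le_mul_abs_self_of_eq_zero_right
    (f := fun t => ∫ u in (0 : ℝ)..t, |D u|) (f' := fun t => |D t|) (K := C) (a := 0) (b := T)
    (fun x _ => (hderiv x).continuousAt.continuousWithinAt)
    (fun x _ => (hderiv x).hasDerivWithinAt) (by simp) (by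
      intro x hx
      simp only [Real.norm_eq_abs, abs_abs]
      rw [abs_of_nonneg (intervalIntegral.integral_nonneg hx.1 fun u _ => abs_nonneg _)]
      exact hbd x ⟨hx.1, hx.2.le⟩)
  have h1 := hbd T ⟨hT, le_rfl⟩
  have h2 := hz T ⟨hT, le_rfl⟩
  rw [h2, mul_zero] at h1
  exact abs_nonpos_iff.1 h1

/-- Uniqueness for linear Volterra equations. -/
theorem volterra_unique {F k x y : ℝ → ℝ} (hk : Continuous k) (hx : Continuous x)
    (hy : Continuous y) (h1 : ∀ t, 0 ≤ t → x t = F t + vconv k x t)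
    (h2 : ∀ t, 0 ≤ t → y t = F t + vconv k y t) : ∀ t, 0 ≤ t → x t = y t := by
  intro t ht
  have := volterra_eq_zero hk (hx.sub hy) (fun t ht => by
    have := vconv_sub_right hk hx hy t
    simp only [Pi.sub_apply]
    rw [h1 t ht, h2 t ht, add_sub_add_left_eq_sub, ← this]
    rfl) t ht
  exact sub_eq_zero.1 this

/-- Solutions of linear Volterra equations with nonnegative kernel and forcing are nonnegative. -/
theorem volterra_nonneg {F k x : ℝ → ℝ} (hk : Continuous k) (hx : Continuous x)
    (hk0 : ∀ t, 0 ≤ t → 0 ≤ k t) (hF : ∀ t, 0 ≤ t → 0 ≤ F t)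
    (h : ∀ t, 0 ≤ t → x t = F t + vconv k x t) : ∀ t, 0 ≤ t → 0 ≤ x t := by
  intro t ht
  -- The negative part `N` of `x` satisfies `N ≤ k ∗ N` because `F` and `k` are nonnegative, so it
  -- is killed by the homogeneous inequality.
  have hN : Continuous fun u => max (-x u) 0 := by fun_prop
  have := volterra_eq_zero hk hN (fun t ht => by
    have h0 : 0 ≤ vconv k (fun u => max (-x u) 0) t :=
      vconv_nonneg ht (fun u hu _ => hk0 u hu) fun u _ _ => le_max_right _ _
    rw [abs_of_nonneg (le_max_right _ _), abs_of_nonneg h0]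
    refine max_le ?_ h0
    have h1 : -vconv k x t ≤ vconv k (fun u => max (-x u) 0) t := by
      unfold vconv
      rw [← intervalIntegral.integral_neg]
      refine intervalIntegral.integral_mono_on ht (Continuous.intervalIntegrable (by fun_prop) _ _)
        (Continuous.intervalIntegrable (by fun_prop) _ _) fun u hu => ?_
      rw [← mul_neg]
      exact mul_le_mul_of_nonneg_left (le_max_left _ _) (hk0 u hu.1)
    linarith [h t ht, hF t ht]) t ht
  linarith [le_max_left (-x t) 0]

theorem abs_vconv_le {k x : ℝ → ℝ} {B t : ℝ} (hk : Continuous k) (hx : Continuous x)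
    (hk0 : ∀ u, 0 ≤ u → 0 ≤ k u) (hki : IntegrableOn k (Set.Ioi 0)) (ht : 0 ≤ t)
    (hB : ∀ u, 0 ≤ u → |x u| ≤ B) : |vconv k x t| ≤ (∫ u in Set.Ioi 0, k u) * B := by
  have hB0 : 0 ≤ B := (abs_nonneg _).trans (hB 0 le_rfl)
  have h1 : |vconv k x t| ≤ ∫ u in (0 : ℝ)..t, k u * B := by
    unfold vconv
    refine (intervalIntegral.abs_integral_le_integral_abs ht).trans ?_
    refine intervalIntegral.integral_mono_on ht (Continuous.intervalIntegrable (by fun_prop) _ _)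
      (Continuous.intervalIntegrable (by fun_prop) _ _) fun u hu => ?_
    rw [abs_mul, abs_of_nonneg (hk0 u hu.1)]
    exact mul_le_mul_of_nonneg_left (hB _ (by linarith [hu.2])) (hk0 u hu.1)
  refine h1.trans ?_
  rw [intervalIntegral.integral_mul_const]
  refine mul_le_mul_of_nonneg_right ?_ hB0
  rw [intervalIntegral.integral_of_le ht]
  exact setIntegral_mono_set hki
    ((ae_restrict_iff' measurableSet_Ioi).2 (ae_of_all _ fun u hu => hk0 u (le_of_lt hu)))
    (Eventually.of_forall fun u hu => hu.1)

/-- Dominated convergence on the half-line after extending the integrand by zero beyond `t`; the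
dominating function is `|k| B`. -/
theorem tendsto_vconv {k x : ℝ → ℝ} {B L : ℝ} (hk : Continuous k) (hx : Continuous x)
    (hki : IntegrableOn k (Set.Ioi 0)) (hB : ∀ u, 0 ≤ u → |x u| ≤ B)
    (hL : Tendsto x atTop (𝓝 L)) :
    Tendsto (vconv k x) atTop (𝓝 ((∫ u in Set.Ioi 0, k u) * L)) := by
  have h1 : ∀ t : ℝ, 0 ≤ t → vconv k x t =
      ∫ u in Set.Ioi 0, (Set.Iic t).indicator (fun u => k u * x (t - u)) u := by
    intro t ht
    rw [setIntegral_indicator measurableSet_Iic, vconv, intervalIntegral.integral_of_le ht]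
    rfl
  rw [← integral_mul_const]
  refine Tendsto.congr' ((eventually_ge_atTop 0).mono fun t ht => (h1 t ht).symm) ?_
  refine tendsto_integral_filter_of_dominated_convergence (fun u => |k u| * B) ?_ ?_
    (hki.abs.mul_const B) ?_
  · exact Eventually.of_forall fun t =>
      ((Continuous.aestronglyMeasurable (by fun_prop)).indicator measurableSet_Iic)
  · refine Eventually.of_forall fun t => ae_of_all _ fun u => ?_
    by_cases hu : u ≤ t
    · rw [Set.indicator_of_mem (by exact hu), Real.norm_eq_abs, abs_mul]
      exact mul_le_mul_of_nonneg_left (hB _ (by linarith)) (abs_nonneg _)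
    · rw [Set.indicator_of_notMem (by exact hu), norm_zero]
      exact mul_nonneg (abs_nonneg _) ((abs_nonneg _).trans (hB 0 le_rfl))
  · refine ae_of_all _ fun u => ?_
    have : Tendsto (fun t => k u * x (t - u)) atTop (𝓝 (k u * L)) :=
      (hL.comp (tendsto_atTop_add_const_right _ (-u) tendsto_id)).const_mul _
    refine this.congr' ((eventually_ge_atTop u).mono fun t ht => ?_)
    exact (Set.indicator_of_mem (show u ∈ Set.Iic t from ht) fun u => k u * x (t - u)).symm

open BoundedContinuousFunction in
/-- Existence for linear Volterra equations with a nonnegative kernel of mass less than `1`,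
with the limit at infinity of the solution. -/
theorem volterra_exists {F k : ℝ → ℝ} {C : ℝ} (hF : Continuous F) (hk : Continuous k)
    (hk0 : ∀ u, 0 ≤ u → 0 ≤ k u) (hki : IntegrableOn k (Set.Ioi 0))
    (hn : ∫ u in Set.Ioi 0, k u < 1) (hC : ∀ t, 0 ≤ t → |F t| ≤ C) :
    ∃ x : ℝ → ℝ, Continuous x ∧ (∀ t, 0 ≤ t → x t = F t + vconv k x t) ∧
      ∀ L, Tendsto F atTop (𝓝 L) → Tendsto x atTop (𝓝 (L / (1 - ∫ u in Set.Ioi 0, k u))) := by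
  set n := ∫ u in Set.Ioi 0, k u with hn_def
  have hn0 : 0 ≤ n := setIntegral_nonneg measurableSet_Ioi fun u hu => hk0 u (le_of_lt hu)
  -- The Volterra map is read at `|t|`, so that it acts on bounded continuous functions on all of
  -- `ℝ` although `F` is controlled only on the half-line.
  obtain ⟨T, hT⟩ : ∃ T : (ℝ →ᵇ ℝ) → (ℝ →ᵇ ℝ),
      ∀ (x : ℝ →ᵇ ℝ) (t : ℝ), T x t = F |t| + vconv k x |t| :=
    ⟨fun x => BoundedContinuousFunction.ofNormedAddCommGroup (fun t => F |t| + vconv k x |t|)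
      ((hF.comp continuous_abs).add ((continuous_vconv hk x.continuous).comp continuous_abs))
      (C + n * ‖x‖) fun t => (norm_add_le _ _).trans (add_le_add (hC _ (abs_nonneg t))
        (abs_vconv_le hk x.continuous hk0 hki (abs_nonneg t) fun u _ => x.norm_coe_le_norm u)),
      fun _ _ => rfl⟩
  have hcontr : ContractingWith ⟨n, hn0⟩ T := by
    refine ⟨by exact_mod_cast hn, LipschitzWith.of_dist_le_mul fun x y => ?_⟩
    refine (BoundedContinuousFunction.dist_le (mul_nonneg hn0 dist_nonneg)).2 fun t => ?_
    rw [Real.dist_eq, hT, hT, add_sub_add_left_eq_sub,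
      ← vconv_sub_right hk x.continuous y.continuous]
    refine abs_vconv_le hk (x.continuous.sub y.continuous) hk0 hki (abs_nonneg t) fun u _ => ?_
    rw [← Real.dist_eq]
    exact BoundedContinuousFunction.dist_coe_le_dist u
  -- The fixed point lies in every nonempty closed invariant set. Applied to the functions
  -- converging to `L / (1 - n)`, the fixed point of `ℓ ↦ L + n ℓ`, this yields the limit at
  -- infinity.
  obtain ⟨z, hz, hmem⟩ : ∃ z : ℝ →ᵇ ℝ, T z = z ∧
      ∀ S : Set (ℝ →ᵇ ℝ), IsClosed S → S.Nonempty → Set.MapsTo T S S → z ∈ S := by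
    refine ⟨hcontr.fixedPoint, hcontr.fixedPoint_isFixedPt, ?_⟩
    rintro S hS ⟨x, hx⟩ hmaps
    obtain ⟨y, hy, hfix, -⟩ := ContractingWith.exists_fixedPoint' hS.isComplete hmaps
      (hcontr.restrict hmaps) hx (edist_ne_top _ _)
    rwa [← hcontr.fixedPoint_unique hfix]
  have hfix : ∀ t : ℝ, z t = F |t| + vconv k z |t| := by
    intro t
    rw [← hT, hz]
  refine ⟨z, z.continuous, fun t ht => ?_, fun L hL => ?_⟩
  · have := hfix t
    rwa [abs_of_nonneg ht] at this
  · refine hmem {x | Tendsto x atTop (𝓝 (L / (1 - n)))} ?_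
      ⟨BoundedContinuousFunction.const ℝ (L / (1 - n)), tendsto_const_nhds⟩ ?_
    · refine isClosed_of_closure_subset fun x hx => ?_
      refine Metric.tendsto_nhds.2 fun ε hε => ?_
      obtain ⟨y, hy, hxy⟩ := Metric.mem_closure_iff.1 hx (ε / 2) (half_pos hε)
      filter_upwards [Metric.tendsto_nhds.1 hy (ε / 2) (half_pos hε)] with t ht
      calc dist (x t) _ ≤ dist (x t) (y t) + dist (y t) _ := dist_triangle _ _ _
        _ < ε := by
          linarith [BoundedContinuousFunction.dist_coe_le_dist (f := x) (g := y) t]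
    · intro x hx
      have h1 := hL.add (tendsto_vconv hk x.continuous hki
        (fun u _ => x.norm_coe_le_norm u) hx)
      have h2 : L + n * (L / (1 - n)) = L / (1 - n) := by
        have : 1 - n ≠ 0 := by linarith
        field_simp; ring
      rw [h2] at h1
      refine h1.congr' ((eventually_ge_atTop 0).mono fun t ht => ?_)
      rw [hT, abs_of_nonneg ht]

/-- Existence for linear Volterra equations, with exponential weights. -/
theorem volterra_exists_exp {F k : ℝ → ℝ} {C : ℝ} (γ : ℝ) (hF : Continuous F) (hk : Continuous k)
    (hk0 : ∀ u, 0 ≤ u → 0 ≤ k u) (hki : IntegrableOn (fun u => Real.exp (-γ * u) * k u) (Set.Ioi 0))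
    (hn : ∫ u in Set.Ioi 0, Real.exp (-γ * u) * k u < 1)
    (hC : ∀ t, 0 ≤ t → |Real.exp (-γ * t) * F t| ≤ C) :
    ∃ x : ℝ → ℝ, Continuous x ∧ (∀ t, 0 ≤ t → x t = F t + vconv k x t) ∧
      ∀ L, Tendsto (fun t => Real.exp (-γ * t) * F t) atTop (𝓝 L) →
        Tendsto (fun t => Real.exp (-γ * t) * x t) atTop
          (𝓝 (L / (1 - ∫ u in Set.Ioi 0, Real.exp (-γ * u) * k u))) := by
  obtain ⟨x, hx, hx_eq, hlim⟩ := volterra_exists (by fun_prop)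
    (by fun_prop) (fun u hu => mul_nonneg (Real.exp_pos _).le (hk0 u hu)) hki hn hC
  have hcancel : ∀ t, Real.exp (-γ * t) * (Real.exp (γ * t) * x t) = x t := fun t => by
    rw [← mul_assoc, ← Real.exp_add]; simp
  refine ⟨fun t => Real.exp (γ * t) * x t, by fun_prop, fun t ht => ?_, fun L hL => ?_⟩
  · have h1 := exp_mul_vconv k (fun t => Real.exp (γ * t) * x t) (-γ) t
    simp only [hcancel] at h1
    have h2 : Real.exp (γ * t) * Real.exp (-γ * t) = 1 := by rw [← Real.exp_add]; simp
    have h3 : vconv (fun u => Real.exp (-γ * u) * k u) x t =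
        Real.exp (-γ * t) * vconv k (fun t => Real.exp (γ * t) * x t) t := h1.symm
    have h4 := hx_eq t ht
    rw [h3, ← mul_add] at h4
    change Real.exp (γ * t) * x t = _
    rw [h4, ← mul_assoc, h2, one_mul]
  · simp only [hcancel]
    exact hlim L hL

/-! ### The semicircle law: moments and moment generating function. -/

theorem integral_semicircle {σ : ℝ} (hσ : 0 < σ) (f : ℝ → ℝ) :
    ∫ x, f x ∂semicircle σ =
      ∫ x in (-σ)..σ, 2 / (Real.pi * σ ^ 2) * √(σ ^ 2 - x ^ 2) * f x := by
  unfold semicircle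
  rw [integral_withDensity_eq_integral_toReal_smul (by fun_prop) (by simp)]
  have h1 : ∀ x, (ENNReal.ofReal (2 / (Real.pi * σ ^ 2) * √(σ ^ 2 - x ^ 2))).toReal • f x =
      2 / (Real.pi * σ ^ 2) * √(σ ^ 2 - x ^ 2) * f x := fun x => by
    rw [ENNReal.toReal_ofReal (by positivity), smul_eq_mul]
  simp_rw [h1]
  rw [intervalIntegral.integral_of_le (by linarith), ← integral_Icc_eq_integral_Ioc,
    setIntegral_eq_integral_of_forall_compl_eq_zero]
  intro x hx
  have : σ ^ 2 - x ^ 2 ≤ 0 := by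
    by_contra! h
    exact hx (abs_le.1 (abs_le_of_sq_le_sq (by linarith) hσ.le))
  rw [Real.sqrt_eq_zero_of_nonpos this]; ring

theorem hasDerivAt_sqrt_sq_sub {σ x : ℝ} (hx : 0 < σ ^ 2 - x ^ 2) :
    HasDerivAt (fun x => √(σ ^ 2 - x ^ 2)) (-x / √(σ ^ 2 - x ^ 2)) x := by
  have := ((hasDerivAt_pow 2 x).const_sub (σ ^ 2)).sqrt hx.ne'
  convert! this using 1
  have h2 := Real.sqrt_pos.2 hx
  simp
  field_simp

theorem sq_sub_sq_pos {σ x : ℝ} (hx : x ∈ Set.Ioo (-σ) σ) : 0 < σ ^ 2 - x ^ 2 := by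
  nlinarith [hx.1, hx.2]

theorem integral_sqrt_sq_sub_sq {σ : ℝ} (hσ : 0 < σ) :
    ∫ x in (-σ)..σ, √(σ ^ 2 - x ^ 2) = Real.pi * σ ^ 2 / 2 := by
  have := intervalIntegral.integral_comp_mul_left (a := -1) (b := 1)
    (fun x => √(σ ^ 2 - x ^ 2)) hσ.ne'
  simp only [mul_neg, mul_one, smul_eq_mul] at this
  have h2 : ∀ x : ℝ, √(σ ^ 2 - (σ * x) ^ 2) = σ * √(1 - x ^ 2) := fun x => by
    rw [show σ ^ 2 - (σ * x) ^ 2 = σ ^ 2 * (1 - x ^ 2) by ring, Real.sqrt_mul (by positivity),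
      Real.sqrt_sq hσ.le]
  simp_rw [h2] at this
  rw [intervalIntegral.integral_const_mul, integral_sqrt_one_sub_sq] at this
  field_simp at this
  linarith

/-- The moments `∫ xⁿ √(σ² - x²)` satisfy a two-step recursion. -/
theorem moment_recurrence {σ : ℝ} (hσ : 0 < σ) (n : ℕ) :
    (n + 4) * ∫ x in (-σ)..σ, √(σ ^ 2 - x ^ 2) * x ^ (n + 2) =
      (n + 1) * σ ^ 2 * ∫ x in (-σ)..σ, √(σ ^ 2 - x ^ 2) * x ^ n := by
  -- Integrate the derivative of `x^(n+1) (σ² - x²)^(3/2)`, which vanishes at both endpoints.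
  have h := intervalIntegral.integral_eq_sub_of_hasDerivAt_of_le (a := -σ) (b := σ)
    (f := fun x => x ^ (n + 1) * ((σ ^ 2 - x ^ 2) * √(σ ^ 2 - x ^ 2)))
    (f' := fun x => (n + 1) * σ ^ 2 * (√(σ ^ 2 - x ^ 2) * x ^ n)
      - (n + 4) * (√(σ ^ 2 - x ^ 2) * x ^ (n + 2))) (by linarith)
    (Continuous.continuousOn (by fun_prop)) (by
      intro x hx
      have h0 := sq_sub_sq_pos hx
      have h1 := (hasDerivAt_pow (n + 1) x).mul
        (((hasDerivAt_pow 2 x).const_sub (σ ^ 2)).mul (hasDerivAt_sqrt_sq_sub h0))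
      convert! h1 using 1
      have h3 : (σ ^ 2 - x ^ 2) * (-x / √(σ ^ 2 - x ^ 2)) = - x * √(σ ^ 2 - x ^ 2) := by
        have h2 := Real.sqrt_pos.2 h0
        field_simp
        rw [Real.sq_sqrt h0.le]
      simp only [Pi.mul_apply, h3]
      push_cast
      ring) (Continuous.intervalIntegrable (by fun_prop) _ _)
  rw [intervalIntegral.integral_sub (Continuous.intervalIntegrable (by fun_prop) _ _)
    (Continuous.intervalIntegrable (by fun_prop) _ _), intervalIntegral.integral_const_mul,
    intervalIntegral.integral_const_mul] at h
  simp at h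
  linarith

theorem even_moment_semicircle {σ : ℝ} (hσ : 0 < σ) (n : ℕ) :
    ∫ x in (-σ)..σ, 2 / (Real.pi * σ ^ 2) * √(σ ^ 2 - x ^ 2) * x ^ (2 * n) =
      catalan n * (σ ^ 2 / 4) ^ n := by
  simp_rw [mul_assoc]
  rw [intervalIntegral.integral_const_mul]
  induction n with
  | zero =>
    simp only [mul_zero, pow_zero, mul_one, integral_sqrt_sq_sub_sq hσ, catalan_zero]
    have := Real.pi_pos
    field_simp
    simp
  | succ n ih =>
    have h := moment_recurrence hσ (2 * n)
    push_cast at h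
    -- The Catalan numbers obey the same two-term recursion as the even moments.
    have hc : ((n : ℝ) + 2) * catalan (n + 1) = 2 * (2 * n + 1) * catalan n := by
      have h1 := succ_mul_catalan_eq_centralBinom n
      have h2 := succ_mul_catalan_eq_centralBinom (n + 1)
      have h3 := Nat.succ_mul_centralBinom_succ n
      have : (n + 1) * ((n + 2) * catalan (n + 1)) = (n + 1) * (2 * (2 * n + 1) * catalan n) := by
        rw [show n + 2 = n + 1 + 1 from rfl, h2, h3, ← h1]; ring
      exact_mod_cast Nat.eq_of_mul_eq_mul_left (Nat.succ_pos n) this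
    have h4 : (2 * (n : ℝ) + 4) * (2 / (Real.pi * σ ^ 2) *
        ∫ x in (-σ)..σ, √(σ ^ 2 - x ^ 2) * x ^ (2 * (n + 1))) =
        (2 * n + 4) * (catalan (n + 1) * (σ ^ 2 / 4) ^ (n + 1)) := by
      rw [show 2 * (n + 1) = 2 * n + 2 by ring, mul_left_comm, h]
      calc _ = (2 * n + 1) * σ ^ 2 * (2 / (Real.pi * σ ^ 2) *
            ∫ x in (-σ)..σ, √(σ ^ 2 - x ^ 2) * x ^ (2 * n)) := by ring
        _ = _ := by rw [ih, pow_succ]; linear_combination (-(σ ^ 2 / 4) ^ n * σ ^ 2 / 2) * hc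
    exact mul_left_cancel₀ (by positivity) h4

/-- The moment generating function of the semicircle law. -/
noncomputable def semicircleMgf (σ t : ℝ) : ℝ := ∫ x, Real.exp (x * t) ∂semicircle σ

theorem semicircleMgf_eq {σ : ℝ} (hσ : 0 < σ) (t : ℝ) : semicircleMgf σ t =
    ∫ x in (-σ)..σ, 2 / (Real.pi * σ ^ 2) * √(σ ^ 2 - x ^ 2) * Real.exp (x * t) :=
  integral_semicircle hσ _

theorem continuous_semicircleMgf {σ : ℝ} (hσ : 0 < σ) : Continuous (semicircleMgf σ) := by
  rw [funext (semicircleMgf_eq hσ)]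
  exact intervalIntegral.continuous_parametric_intervalIntegral_of_continuous'
    (f := fun t x => 2 / (Real.pi * σ ^ 2) * √(σ ^ 2 - x ^ 2) * Real.exp (x * t)) (by fun_prop) _ _

theorem semicircleMgf_eq_cosh {σ : ℝ} (hσ : 0 < σ) (t : ℝ) : semicircleMgf σ t =
    ∫ x in (-σ)..σ, 2 / (Real.pi * σ ^ 2) * √(σ ^ 2 - x ^ 2) * Real.cosh (x * t) := by
  have h1 := semicircleMgf_eq hσ t
  have h2 : semicircleMgf σ t =
      ∫ x in (-σ)..σ, 2 / (Real.pi * σ ^ 2) * √(σ ^ 2 - x ^ 2) * Real.exp (-(x * t)) := by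
    rw [h1]
    have := intervalIntegral.integral_comp_neg (a := -σ) (b := σ)
      (fun x => 2 / (Real.pi * σ ^ 2) * √(σ ^ 2 - x ^ 2) * Real.exp (x * t))
    simpa using this.symm
  have h3 : semicircleMgf σ t = (semicircleMgf σ t + semicircleMgf σ t) / 2 := by ring
  rw [h3]
  nth_rewrite 1 [h1]
  rw [h2, ← intervalIntegral.integral_add (Continuous.intervalIntegrable (by fun_prop) _ _)
    (Continuous.intervalIntegrable (by fun_prop) _ _), ← intervalIntegral.integral_div]
  exact intervalIntegral.integral_congr fun x _ => by simp only [Real.cosh_eq]; ring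

/-- By symmetry of the law only the hyperbolic cosine survives. Its series is integrated term by
term and the even moments are Catalan numbers. -/
theorem hasSum_semicircleMgf {σ : ℝ} (hσ : 0 < σ) (t : ℝ) :
    HasSum (fun n : ℕ => (catalan n * (σ ^ 2 / 4) ^ n : ℝ) * (t ^ (2 * n) / (2 * n).factorial))
      (semicircleMgf σ t) := by
  rw [semicircleMgf_eq_cosh hσ]
  have h := intervalIntegral.hasSum_integral_of_dominated_convergence (μ := volume) (a := -σ) (b := σ)
    (F := fun (n : ℕ) x => 2 / (Real.pi * σ ^ 2) * √(σ ^ 2 - x ^ 2) *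
      ((x * t) ^ (2 * n) / (2 * n).factorial))
    (f := fun x => 2 / (Real.pi * σ ^ 2) * √(σ ^ 2 - x ^ 2) * Real.cosh (x * t))
    (fun n x => 2 / (Real.pi * σ ^ 2) * √(σ ^ 2 - x ^ 2) *
      ((σ * t) ^ (2 * n) / (2 * n).factorial))
    (fun n => Continuous.aestronglyMeasurable (by fun_prop)) ?_ ?_ ?_ ?_
  · refine h.congr_fun fun n => ?_
    rw [← even_moment_semicircle hσ, ← intervalIntegral.integral_mul_const]
    exact intervalIntegral.integral_congr fun x _ => by ring
  · refine fun n => ae_of_all _ fun x hx => ?_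
    rw [Set.uIoc_of_le (by linarith)] at hx
    rw [Real.norm_eq_abs, abs_of_nonneg (mul_nonneg (by positivity)
      (div_nonneg (Even.pow_nonneg ⟨n, by ring⟩ _) (by positivity)))]
    refine mul_le_mul_of_nonneg_left (div_le_div_of_nonneg_right ?_ (by positivity)) (by positivity)
    rw [pow_mul, pow_mul]
    refine pow_le_pow_left₀ (by positivity) ?_ n
    nlinarith [mul_nonneg (sq_nonneg t) (show 0 ≤ σ ^ 2 - x ^ 2 by nlinarith [hx.1, hx.2])]
  · exact ae_of_all _ fun x _ => (Real.hasSum_cosh (σ * t)).summable.mul_left _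
  · simp_rw [tsum_mul_left]
    exact Continuous.intervalIntegrable (by fun_prop) _ _
  · exact ae_of_all _ fun x _ => (Real.hasSum_cosh (x * t)).mul_left _

/-- Each `xⁿ/n!` is an iterated convolution of the constant `1`, so this is associativity; it
replaces a beta integral. -/
theorem vconv_pow_div_factorial (p q : ℕ) {t : ℝ} (ht : 0 ≤ t) :
    vconv (fun x => x ^ p / p.factorial) (fun x => x ^ q / q.factorial) t =
      t ^ (p + q + 1) / (p + q + 1).factorial := by
  have hone : ∀ (n : ℕ) (t : ℝ), vconv (fun _ => 1) (fun x => x ^ n / n.factorial) t =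
      t ^ (n + 1) / (n + 1).factorial := by
    intro n t
    rw [vconv_one_left, intervalIntegral.integral_div, integral_pow, Nat.factorial_succ]
    push_cast
    simp only [ne_eq, Nat.add_eq_zero_iff, one_ne_zero, and_false, not_false_eq_true, zero_pow,
      sub_zero]
    rw [div_div]
  induction p generalizing t with
  | zero => simp only [pow_zero, Nat.factorial_zero, Nat.cast_one, div_one, zero_add, hone]
  | succ p ih =>
    rw [← funext (hone p), vconv_assoc (by fun_prop) (by fun_prop) (by fun_prop) ht,
      vconv_congr ht (fun _ _ _ => rfl) (fun x hx _ => ih hx), hone]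
    congr 2 <;> ring_nf

theorem hasSum_mul_of_nonneg {ι κ : Type*} {u : ι → ℝ} {v : κ → ℝ} {U V : ℝ}
    (hu : ∀ i, 0 ≤ u i) (hv : ∀ j, 0 ≤ v j) (hU : HasSum u U) (hV : HasSum v V) :
    HasSum (fun z : ι × κ => u z.1 * v z.2) (U * V) :=
  hU.mul hV (Summable.mul_of_nonneg hU.summable hV.summable hu hv)

/-- Convolution of power series with nonnegative coefficients. -/
theorem hasSum_vconv {ι κ : Type*} [Countable ι] [Countable κ] {a : ι → ℝ} {b : κ → ℝ}
    {p : ι → ℕ} {q : κ → ℕ} {f g : ℝ → ℝ} (ha : ∀ i, 0 ≤ a i) (hb : ∀ j, 0 ≤ b j)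
    (hf : ∀ x, 0 ≤ x → HasSum (fun i => a i * (x ^ p i / (p i).factorial)) (f x))
    (hg : ∀ x, 0 ≤ x → HasSum (fun j => b j * (x ^ q j / (q j).factorial)) (g x))
    {t : ℝ} (ht : 0 ≤ t) :
    HasSum (fun z : ι × κ => a z.1 * b z.2 *
      (t ^ (p z.1 + q z.2 + 1) / (p z.1 + q z.2 + 1).factorial)) (vconv f g t) := by
  have hprod : ∀ x y, 0 ≤ x → 0 ≤ y → HasSum (fun z : ι × κ =>
      a z.1 * (x ^ p z.1 / (p z.1).factorial) * (b z.2 * (y ^ q z.2 / (q z.2).factorial)))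
      (f x * g y) := by
    intro x y hx hy
    have hu : ∀ i, 0 ≤ a i * (x ^ p i / (p i).factorial) :=
      fun i => mul_nonneg (ha i) (div_nonneg (pow_nonneg hx _) (Nat.cast_nonneg _))
    have hv : ∀ j, 0 ≤ b j * (y ^ q j / (q j).factorial) :=
      fun i => mul_nonneg (hb i) (div_nonneg (pow_nonneg hy _) (Nat.cast_nonneg _))
    have hU := hf x hx
    have hV := hg y hy
    have := hasSum_mul_of_nonneg hu hv hU hV
    exact this
  have h := intervalIntegral.hasSum_integral_of_dominated_convergence (μ := volume) (a := 0) (b := t)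
    (F := fun (z : ι × κ) x => a z.1 * (x ^ p z.1 / (p z.1).factorial) *
      (b z.2 * ((t - x) ^ q z.2 / (q z.2).factorial)))
    (f := fun x => f x * g (t - x))
    (fun z x => a z.1 * (t ^ p z.1 / (p z.1).factorial) *
      (b z.2 * (t ^ q z.2 / (q z.2).factorial)))
    (fun z => Continuous.aestronglyMeasurable (by fun_prop)) ?_ ?_ ?_ ?_
  · refine h.congr_fun fun z => ?_
    rw [← vconv_pow_div_factorial _ _ ht, vconv, ← intervalIntegral.integral_const_mul]
    exact intervalIntegral.integral_congr fun x _ => by ring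
  · refine fun z => ae_of_all _ fun x hx => ?_
    rw [Set.uIoc_of_le ht] at hx
    have h1 : 0 ≤ t - x := by linarith [hx.2]
    have h2 := hx.1.le
    have := ha z.1
    have := hb z.2
    rw [Real.norm_eq_abs, abs_of_nonneg (by positivity)]
    gcongr
    · exact hx.2
    · linarith
  · exact ae_of_all _ fun x _ => (hprod t t ht ht).summable
  · exact intervalIntegrable_const
  · refine ae_of_all _ fun x hx => ?_
    rw [Set.uIoc_of_le ht] at hx
    exact hprod x (t - x) hx.1.le (by linarith [hx.2])

/-- The quadratic equation of the semicircle law, in the time domain: `m' = (σ² / 4) m ∗ m`. -/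
theorem semicircleMgf_eq_one_add {σ : ℝ} (hσ : 0 < σ) {t : ℝ} (ht : 0 ≤ t) :
    semicircleMgf σ t = 1 + σ ^ 2 / 4 *
      vconv (fun _ => 1) (vconv (semicircleMgf σ) (semicircleMgf σ)) t := by
  have hnn : ∀ n : ℕ, 0 ≤ (catalan n * (σ ^ 2 / 4) ^ n : ℝ) := fun n => by positivity
  have h1 := hasSum_vconv (t := t) (fun _ : Unit => zero_le_one (α := ℝ))
    (fun z : ℕ × ℕ => mul_nonneg (hnn z.1) (hnn z.2)) (p := fun _ => 0)
    (f := fun _ => 1) (fun x _ => by simp)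
    (fun x hx => hasSum_vconv hnn hnn (fun x _ => hasSum_semicircleMgf hσ x)
      (fun x _ => hasSum_semicircleMgf hσ x) hx) ht
  -- Group the double series along antidiagonals; the resulting coefficients are Segner's recursion
  -- `C_{n+1} = ∑ C_i C_j`.
  rw [← (Equiv.punitProd (ℕ × ℕ)).symm.hasSum_iff,
    ← Finset.HasAntidiagonal.sigmaAntidiagonalEquivProd.hasSum_iff] at h1
  have h2 := (h1.sigma fun n => hasSum_fintype _).mul_left (σ ^ 2 / 4)
  have h3 := (hasSum_nat_add_iff' 1).2 (hasSum_semicircleMgf hσ t)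
  simp only [Finset.range_one, Finset.sum_singleton, catalan_zero, mul_zero, pow_zero,
    Nat.factorial_zero, Nat.cast_one, div_one, mul_one] at h3
  have h4 := h3.unique (h2.congr_fun fun n => ?_)
  · linarith
  · rw [catalan_succ']
    push_cast
    rw [Finset.sum_mul, Finset.sum_mul, Finset.mul_sum, ← Finset.sum_coe_sort]
    refine Finset.sum_congr rfl fun z _ => ?_
    obtain ⟨⟨i, j⟩, hz⟩ := z
    obtain rfl : i + j = n := Finset.HasAntidiagonal.mem_antidiagonal.1 hz
    simp only [Function.comp, Finset.HasAntidiagonal.sigmaAntidiagonalEquivProd_apply, Equiv.punitProd_symm_apply]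
    rw [show 0 + (2 * i + 2 * j + 1) + 1 = 2 * (i + j + 1) by ring]
    ring

theorem semicircleMgf_zero {σ : ℝ} (hσ : 0 < σ) : semicircleMgf σ 0 = 1 := by
  rw [semicircleMgf_eq_one_add hσ le_rfl]; simp [vconv]

theorem semicircleMgf_nonneg (σ t : ℝ) : 0 ≤ semicircleMgf σ t :=
  integral_nonneg fun _ => (Real.exp_pos _).le

theorem one_le_semicircleMgf {σ : ℝ} (hσ : 0 < σ) {t : ℝ} (ht : 0 ≤ t) :
    1 ≤ semicircleMgf σ t := by
  rw [semicircleMgf_eq_one_add hσ ht]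
  have : 0 ≤ vconv (fun _ => 1) (vconv (semicircleMgf σ) (semicircleMgf σ)) t :=
    vconv_nonneg ht (fun _ _ _ => zero_le_one) fun x hx _ =>
      vconv_nonneg hx (fun _ _ _ => semicircleMgf_nonneg _ _) fun _ _ _ => semicircleMgf_nonneg _ _
  nlinarith [sq_nonneg σ]

theorem semicircleMgf_le {σ : ℝ} (hσ : 0 < σ) {t : ℝ} (ht : 0 ≤ t) :
    semicircleMgf σ t ≤ Real.exp (σ * t) := by
  have h0 := semicircleMgf_zero hσ
  rw [semicircleMgf_eq hσ] at h0
  have h1 : Real.exp (σ * t) = ∫ x in (-σ)..σ,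
      2 / (Real.pi * σ ^ 2) * √(σ ^ 2 - x ^ 2) * Real.exp (x * 0) * Real.exp (σ * t) := by
    rw [intervalIntegral.integral_mul_const, h0, one_mul]
  rw [semicircleMgf_eq hσ, h1]
  refine intervalIntegral.integral_mono_on (by linarith)
    (Continuous.intervalIntegrable (by fun_prop) _ _)
    (Continuous.intervalIntegrable (by fun_prop) _ _) fun x hx => ?_
  rw [mul_zero, Real.exp_zero, mul_one]
  gcongr
  exact hx.2

theorem hasDerivAt_vconv_one {f : ℝ → ℝ} (hf : Continuous f) (t : ℝ) :
    HasDerivAt (vconv (fun _ => 1) f) (f t) t := by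
  rw [funext (vconv_one_left f)]
  exact intervalIntegral.integral_hasDerivAt_right (hf.intervalIntegrable _ _)
    (hf.stronglyMeasurableAtFilter _ _) hf.continuousAt

theorem hasDerivAt_semicircleMgf {σ : ℝ} (hσ : 0 < σ) {t : ℝ} (ht : 0 < t) :
    HasDerivAt (semicircleMgf σ)
      (σ ^ 2 / 4 * vconv (semicircleMgf σ) (semicircleMgf σ) t) t := by
  have hm := continuous_semicircleMgf hσ
  have := ((hasDerivAt_vconv_one (continuous_vconv hm hm) t).const_mul (σ ^ 2 / 4)).const_add 1
  refine this.congr_of_eventuallyEq ?_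
  filter_upwards [lt_mem_nhds ht] with x hx
  exact semicircleMgf_eq_one_add hσ hx.le

/-! ### The Stieltjes transform, in closed form and as a Laplace transform. -/

/-- The Stieltjes transform of the semicircle law to the right of its support. -/
theorem stieltjes_semicircle {σ z : ℝ} (hσ : 0 < σ) (hz : σ < z) :
    stieltjes (semicircle σ) z = 2 / σ ^ 2 * (z - √(z ^ 2 - σ ^ 2)) := by
  unfold stieltjes
  rw [integral_semicircle hσ]
  set d := √(z ^ 2 - σ ^ 2) with hd
  have hzs : 0 < z ^ 2 - σ ^ 2 := by nlinarith
  have hd0 : 0 < d := Real.sqrt_pos.2 hzs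
  have hd2 : d ^ 2 = z ^ 2 - σ ^ 2 := Real.sq_sqrt hzs.le
  have hcont : ContinuousOn (fun x => √(σ ^ 2 - x ^ 2) * (1 / (z - x))) (Set.uIcc (-σ) σ) := by
    rw [Set.uIcc_of_le (by linarith)]
    refine ContinuousOn.mul (by fun_prop) (continuousOn_const.div (by fun_prop) fun x hx => ?_)
    linarith [hx.2]
  -- Since `σ² - x² = (z - x)(z + x) - d²`, the integrand is `(z + x)/√(σ² - x²) - d²/((z - x)√(σ² -
  -- x²))`, and each piece has an elementary primitive. At `x = ±σ` both arcsines have argument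
  -- `±1`, so the integral is `π (z - d)`.
  have h := intervalIntegral.integral_eq_sub_of_hasDerivAt_of_le (a := -σ) (b := σ)
    (f := fun x => z * Real.arcsin (x / σ) - √(σ ^ 2 - x ^ 2)
      - d * Real.arcsin ((z * x - σ ^ 2) / (σ * (z - x))))
    (f' := fun x => √(σ ^ 2 - x ^ 2) * (1 / (z - x))) (by linarith) ?_ ?_ hcont.intervalIntegrable
  · simp_rw [mul_assoc]
    rw [intervalIntegral.integral_const_mul, h]
    have e1 : (z * σ - σ ^ 2) / (σ * (z - σ)) = 1 := by
      rw [div_eq_one_iff_eq (by have : 0 < z - σ := by linarith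
                                positivity)]; ring
    have e2 : (z * -σ - σ ^ 2) / (σ * (z - -σ)) = -1 := by
      rw [div_eq_iff (by have : 0 < z - -σ := by linarith
                         positivity)]; ring
    have e3 : -σ / σ = -1 := by field_simp
    simp only [e1, e2, e3, div_self hσ.ne', Real.arcsin_one, Real.arcsin_neg_one, sub_self,
      even_two.neg_pow, Real.sqrt_zero]
    have := Real.pi_pos
    field_simp
    ring
  · refine ContinuousOn.sub (by fun_prop) (continuousOn_const.mul
      (Real.continuous_arcsin.comp_continuousOn (ContinuousOn.div (by fun_prop) (by fun_prop)
        fun x hx => ?_)))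
    have : 0 < z - x := by linarith [hx.2]
    positivity
  · intro x hx
    have h0 := sq_sub_sq_pos hx
    have hr := Real.sqrt_pos.2 h0
    have hr2 := Real.sq_sqrt h0.le
    have hr' := hasDerivAt_sqrt_sq_sub h0
    set r := √(σ ^ 2 - x ^ 2) with hr_def
    have hzx : 0 < z - x := by linarith [hx.2]
    have hv : 1 - (x / σ) ^ 2 = (r / σ) ^ 2 := by rw [div_pow, div_pow, hr2]; field_simp
    have a1 : √(1 - (x / σ) ^ 2) = r / σ := by
      rw [hv]; exact Real.sqrt_sq (by positivity)
    have hw : 1 - ((z * x - σ ^ 2) / (σ * (z - x))) ^ 2 = (d * r / (σ * (z - x))) ^ 2 := by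
      rw [div_pow, div_pow, mul_pow d, hd2, hr2]; field_simp; ring
    have a2 : √(1 - ((z * x - σ ^ 2) / (σ * (z - x))) ^ 2) = d * r / (σ * (z - x)) := by
      rw [hw]; exact Real.sqrt_sq (by positivity)
    have hne : ∀ w : ℝ, 0 < 1 - w ^ 2 → w ≠ -1 ∧ w ≠ 1 := by
      intro w hw; constructor <;> rintro rfl <;> norm_num at hw
    have b1 := hne (x / σ) (by rw [hv]; positivity)
    have b2 := hne ((z * x - σ ^ 2) / (σ * (z - x))) (by rw [hw]; positivity)
    have c1 := (Real.hasDerivAt_arcsin b1.1 b1.2).comp x ((hasDerivAt_id x).div_const σ)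
    have hq : HasDerivAt (fun x => (z * x - σ ^ 2) / (σ * (z - x)))
        (d ^ 2 / (σ * (z - x) ^ 2)) x := by
      have := (((hasDerivAt_id x).const_mul z).sub_const (σ ^ 2)).div
        (((hasDerivAt_id x).const_sub z).const_mul σ) (by simp only [id]; positivity)
      convert! this using 1
      rw [hd2]
      simp only [id]
      field_simp
      ring
    have c2 := (Real.hasDerivAt_arcsin b2.1 b2.2).comp x hq
    have := ((c1.const_mul z).sub hr').sub (c2.const_mul d)
    convert! this using 1
    rw [a1, a2]
    field_simp
    rw [hr2, hd2]
    ring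

theorem laplace_semicircleMgf_interval {σ z : ℝ} (hσ : 0 < σ) (hz : σ < z) (t : ℝ) :
    ∫ x in (0 : ℝ)..t, Real.exp (-z * x) * semicircleMgf σ x =
      ∫ y in (-σ)..σ, 2 / (Real.pi * σ ^ 2) * √(σ ^ 2 - y ^ 2) *
        ((1 - Real.exp ((y - z) * t)) / (z - y)) := by
  have h1 : ∀ x, Real.exp (-z * x) * semicircleMgf σ x = ∫ y in (-σ)..σ,
      2 / (Real.pi * σ ^ 2) * √(σ ^ 2 - y ^ 2) * Real.exp ((y - z) * x) := by
    intro x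
    rw [semicircleMgf_eq hσ, ← intervalIntegral.integral_const_mul]
    refine intervalIntegral.integral_congr fun y _ => ?_
    have : Real.exp ((y - z) * x) = Real.exp (-z * x) * Real.exp (y * x) := by
      rw [← Real.exp_add]; ring_nf
    simp only [this]; ring
  simp_rw [h1]
  rw [intervalIntegral_intervalIntegral_swap
    (F := fun x y => 2 / (Real.pi * σ ^ 2) * √(σ ^ 2 - y ^ 2) * Real.exp ((y - z) * x))]
  · refine intervalIntegral.integral_congr fun y hy => ?_
    rw [Set.uIcc_of_le (by linarith)] at hy
    have hyz : y - z ≠ 0 := by linarith [hy.2]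
    simp only [intervalIntegral.integral_const_mul]
    congr 1
    rw [intervalIntegral.integral_comp_mul_left (fun x => Real.exp x) hyz, integral_exp]
    have : z - y ≠ 0 := fun h => hyz (by linarith)
    rw [smul_eq_mul, mul_zero, Real.exp_zero]
    field_simp
    ring
  · exact (Continuous.continuousOn (by fun_prop)).integrableOn_compact
      (isCompact_uIcc.prod isCompact_uIcc) |>.mono_set
      (Set.prod_mono Set.uIoc_subset_uIcc Set.uIoc_subset_uIcc)

/-- The tail beyond `t` is the integral of `exp((y - z) t)/(z - y)` against the law, and `y ≤ σ` on
its support. The two-sided bound gives both convergence and, through the sign, monotone control of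
`spikeResponse`. -/
theorem stieltjes_sub_laplace {σ z : ℝ} (hσ : 0 < σ) (hz : σ < z) {t : ℝ} (ht : 0 ≤ t) :
    stieltjes (semicircle σ) z - ∫ x in (0 : ℝ)..t, Real.exp (-z * x) * semicircleMgf σ x ∈
      Set.Icc 0 (Real.exp (-(z - σ) * t) * stieltjes (semicircle σ) z) := by
  rw [laplace_semicircleMgf_interval hσ hz, stieltjes, integral_semicircle hσ]
  have hne : ∀ y ∈ Set.uIcc (-σ) σ, z - y ≠ 0 := fun y hy => by
    rw [Set.uIcc_of_le (by linarith)] at hy; linarith [hy.2]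
  have i1 : IntervalIntegrable (fun y => 2 / (Real.pi * σ ^ 2) * √(σ ^ 2 - y ^ 2) * (1 / (z - y)))
      volume (-σ) σ := ContinuousOn.intervalIntegrable
    (ContinuousOn.mul (by fun_prop) (continuousOn_const.div (by fun_prop) hne))
  have i2 : IntervalIntegrable (fun y => 2 / (Real.pi * σ ^ 2) * √(σ ^ 2 - y ^ 2) *
      ((1 - Real.exp ((y - z) * t)) / (z - y))) volume (-σ) σ := ContinuousOn.intervalIntegrable
    (ContinuousOn.mul (by fun_prop) (ContinuousOn.div (by fun_prop) (by fun_prop) hne))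
  rw [← intervalIntegral.integral_sub i1 i2, ← intervalIntegral.integral_const_mul]
  have key : ∀ y ∈ Set.Icc (-σ) σ,
      2 / (Real.pi * σ ^ 2) * √(σ ^ 2 - y ^ 2) * (1 / (z - y)) -
        2 / (Real.pi * σ ^ 2) * √(σ ^ 2 - y ^ 2) * ((1 - Real.exp ((y - z) * t)) / (z - y)) =
      Real.exp ((y - z) * t) * (2 / (Real.pi * σ ^ 2) * √(σ ^ 2 - y ^ 2) * (1 / (z - y))) :=
    fun y _ => by ring
  have hpos : ∀ y ∈ Set.Icc (-σ) σ,
      0 ≤ 2 / (Real.pi * σ ^ 2) * √(σ ^ 2 - y ^ 2) * (1 / (z - y)) := fun y hy => by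
    have : 0 < z - y := by linarith [hy.2]
    positivity
  constructor
  · refine intervalIntegral.integral_nonneg (by linarith) fun y hy => ?_
    rw [key y hy]
    exact mul_nonneg (Real.exp_pos _).le (hpos y hy)
  · refine intervalIntegral.integral_mono_on (by linarith) (i1.sub i2) (i1.const_mul _)
      fun y hy => ?_
    rw [key y hy]
    refine mul_le_mul_of_nonneg_right (Real.exp_le_exp.2 ?_) (hpos y hy)
    nlinarith [mul_nonneg ht (show 0 ≤ σ - y by linarith [hy.2])]

theorem tendsto_laplace_semicircleMgf {σ z : ℝ} (hσ : 0 < σ) (hz : σ < z) :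
    Tendsto (fun t => ∫ x in (0 : ℝ)..t, Real.exp (-z * x) * semicircleMgf σ x) atTop
      (𝓝 (stieltjes (semicircle σ) z)) := by
  have h1 : Tendsto (fun t : ℝ => Real.exp (-(z - σ) * t) * stieltjes (semicircle σ) z) atTop
      (𝓝 (0 * stieltjes (semicircle σ) z)) :=
    (Real.tendsto_exp_atBot.comp
      (tendsto_id.const_mul_atTop_of_neg (by linarith))).mul_const _
  rw [zero_mul] at h1
  have h2 := squeeze_zero' ((eventually_ge_atTop 0).mono fun t ht =>
    (stieltjes_sub_laplace hσ hz ht).1) ((eventually_ge_atTop 0).mono fun t ht =>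
    (stieltjes_sub_laplace hσ hz ht).2) h1
  simpa using h2.const_sub (stieltjes (semicircle σ) z)

theorem integrableOn_laplace_semicircleMgf {σ z : ℝ} (hσ : 0 < σ) (hz : σ < z) :
    IntegrableOn (fun x => Real.exp (-z * x) * semicircleMgf σ x) (Set.Ioi 0) := by
  have hm := continuous_semicircleMgf hσ
  refine integrableOn_Ioi_of_intervalIntegral_norm_tendsto _ 0
    (fun t => (Continuous.integrableOn_Icc (by fun_prop)).mono_set Set.Ioc_subset_Icc_self)
    tendsto_id (l := atTop) ((tendsto_laplace_semicircleMgf hσ hz).congr fun t => ?_)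
  refine intervalIntegral.integral_congr fun x _ => ?_
  simp only [Real.norm_eq_abs]
  rw [abs_of_nonneg (mul_nonneg (Real.exp_pos _).le (semicircleMgf_nonneg _ _))]

theorem integral_laplace_semicircleMgf {σ z : ℝ} (hσ : 0 < σ) (hz : σ < z) :
    ∫ x in Set.Ioi 0, Real.exp (-z * x) * semicircleMgf σ x = stieltjes (semicircle σ) z :=
  tendsto_nhds_unique (intervalIntegral_tendsto_integral_Ioi 0
    (integrableOn_laplace_semicircleMgf hσ hz) tendsto_id) (tendsto_laplace_semicircleMgf hσ hz)

/-! ### The outlier and the response to a rank one spike. -/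

/-- The location `α + σ² / (4 α)` of the outlier created by a rank one spike of strength `α`. -/
noncomputable def outlier (σ α : ℝ) : ℝ := α + σ ^ 2 / (4 * α)

theorem lt_outlier {σ α : ℝ} (hσ : 0 < σ) (hα : σ / 2 < α) : σ < outlier σ α := by
  have hα0 : 0 < α := by linarith
  have : outlier σ α - σ = (2 * α - σ) ^ 2 / (4 * α) := by unfold outlier; field_simp; ring
  have : 0 < (2 * α - σ) ^ 2 / (4 * α) := div_pos (by nlinarith) (by positivity)
  linarith

/-- With this value of `z`, `z² - σ²` is the square of `α - σ²/(4α)`; the assumption `σ/2 < α`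
selects the sign of the root. -/
theorem stieltjes_outlier {σ α : ℝ} (hσ : 0 < σ) (hα : σ / 2 < α) :
    stieltjes (semicircle σ) (outlier σ α) = 1 / α := by
  have hα0 : 0 < α := by linarith
  rw [stieltjes_semicircle hσ (lt_outlier hσ hα)]
  have h : outlier σ α ^ 2 - σ ^ 2 = (α - σ ^ 2 / (4 * α)) ^ 2 := by
    unfold outlier; field_simp; ring
  have h0 : 0 ≤ α - σ ^ 2 / (4 * α) := by
    rw [sub_nonneg, div_le_iff₀ (by positivity)]; nlinarith
  rw [h, Real.sqrt_sq h0]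
  unfold outlier
  field_simp
  ring

/-- The response `h` of the semicircle law to a rank one spike of strength `α`; it solves
`h = m + α m ∗ h`, where `m` is the moment generating function. -/
noncomputable def spikeResponse (σ α t : ℝ) : ℝ :=
  Real.exp (outlier σ α * t) -
    σ ^ 2 / (4 * α) * vconv (semicircleMgf σ) (fun x => Real.exp (outlier σ α * x)) t

theorem continuous_spikeResponse {σ : ℝ} (hσ : 0 < σ) (α : ℝ) :
    Continuous (spikeResponse σ α) := by
  have := continuous_semicircleMgf hσ
  unfold spikeResponse
  exact Continuous.sub (by fun_prop) (continuous_const.mul (continuous_vconv this (by fun_prop)))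

/-- Integrate the derivative of `x ↦ m(x) exp(z (t - x))`, using `m' = (σ²/4) m ∗ m`. -/
theorem exp_sub_semicircleMgf {σ : ℝ} (hσ : 0 < σ) (z : ℝ) {t : ℝ} (ht : 0 ≤ t) :
    Real.exp (z * t) - semicircleMgf σ t =
      z * vconv (semicircleMgf σ) (fun x => Real.exp (z * x)) t - σ ^ 2 / 4 *
        vconv (vconv (semicircleMgf σ) (semicircleMgf σ)) (fun x => Real.exp (z * x)) t := by
  have hm := continuous_semicircleMgf hσ
  have hmm := continuous_vconv hm hm
  have h := intervalIntegral.integral_eq_sub_of_hasDerivAt_of_le (a := 0) (b := t)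
    (f := fun x => semicircleMgf σ x * Real.exp (z * (t - x)))
    (f' := fun x => σ ^ 2 / 4 * (vconv (semicircleMgf σ) (semicircleMgf σ) x *
      Real.exp (z * (t - x))) - z * (semicircleMgf σ x * Real.exp (z * (t - x))))
    ht (Continuous.continuousOn (by fun_prop)) (by
      intro x hx
      have h1 := ((((hasDerivAt_id x).const_sub t).const_mul z).exp)
      convert! (hasDerivAt_semicircleMgf hσ hx.1).mul h1 using 1
      simp only [id]; ring) (Continuous.intervalIntegrable (by fun_prop) _ _)
  rw [intervalIntegral.integral_sub (Continuous.intervalIntegrable (by fun_prop) _ _)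
    (Continuous.intervalIntegrable (by fun_prop) _ _), intervalIntegral.integral_const_mul,
    intervalIntegral.integral_const_mul] at h
  simp only [sub_self, mul_zero, Real.exp_zero, mul_one, sub_zero, semicircleMgf_zero hσ,
    one_mul] at h
  unfold vconv at h ⊢
  linarith

/-- In Laplace variables the equation says that the transform of `h` is `S/(1 - αS)`. From `z =
σ²S/4 + 1/S` one gets `z - outlier = (1/S - α)(1 - σ²S/(4α))`, which is where the closed form of
`spikeResponse` comes from. -/
theorem spikeResponse_eq {σ α : ℝ} (hσ : 0 < σ) (hα : α ≠ 0) {t : ℝ} (ht : 0 ≤ t) :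
    spikeResponse σ α t =
      semicircleMgf σ t + α * vconv (semicircleMgf σ) (spikeResponse σ α) t := by
  have hm := continuous_semicircleMgf hσ
  have hE : Continuous fun x => Real.exp (outlier σ α * x) := by fun_prop
  have h1 : vconv (semicircleMgf σ) (spikeResponse σ α) t =
      vconv (semicircleMgf σ) (fun x => Real.exp (outlier σ α * x)) t - σ ^ 2 / (4 * α) *
        vconv (vconv (semicircleMgf σ) (semicircleMgf σ))
          (fun x => Real.exp (outlier σ α * x)) t := by
    rw [vconv_assoc hm hm hE ht, ← vconv_const_mul_right]
    exact vconv_sub_right hm hE (k := fun x => σ ^ 2 / (4 * α) *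
      vconv (semicircleMgf σ) (fun x => Real.exp (outlier σ α * x)) x)
      (continuous_const.mul (continuous_vconv hm hE)) t
  have h2 := exp_sub_semicircleMgf hσ (outlier σ α) ht
  have h3 : α * (σ ^ 2 / (4 * α)) = σ ^ 2 / 4 := by field_simp
  have h4 : outlier σ α - σ ^ 2 / (4 * α) = α := by unfold outlier; ring
  rw [h1, spikeResponse]
  linear_combination h2 + vconv (semicircleMgf σ) (fun x => Real.exp (outlier σ α * x)) t * h4
    + vconv (vconv (semicircleMgf σ) (semicircleMgf σ))
          (fun x => Real.exp (outlier σ α * x)) t * h3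

/-- The weighted response is an affine function of a truncated Laplace transform, so its limit and
its bounds are read off from `stieltjes_sub_laplace`. -/
theorem exp_mul_spikeResponse (σ α t : ℝ) : Real.exp (-outlier σ α * t) * spikeResponse σ α t =
    1 - σ ^ 2 / (4 * α) *
      ∫ x in (0 : ℝ)..t, Real.exp (-outlier σ α * x) * semicircleMgf σ x := by
  have h1 : Real.exp (-outlier σ α * t) * Real.exp (outlier σ α * t) = 1 := by
    rw [← Real.exp_add]; simp
  have h2 : Real.exp (-outlier σ α * t) *
      vconv (semicircleMgf σ) (fun x => Real.exp (outlier σ α * x)) t =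
      ∫ x in (0 : ℝ)..t, Real.exp (-outlier σ α * x) * semicircleMgf σ x := by
    rw [exp_mul_vconv]
    unfold vconv
    refine intervalIntegral.integral_congr fun x _ => ?_
    simp only [← Real.exp_add]
    simp
  rw [spikeResponse, mul_sub, h1, ← h2]; ring

theorem tendsto_exp_mul_spikeResponse {σ α : ℝ} (hσ : 0 < σ) (hα : σ / 2 < α) :
    Tendsto (fun t => Real.exp (-outlier σ α * t) * spikeResponse σ α t) atTop
      (𝓝 (1 - σ ^ 2 / (4 * α ^ 2))) := by
  have h := ((tendsto_laplace_semicircleMgf hσ (lt_outlier hσ hα)).const_mul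
    (σ ^ 2 / (4 * α))).const_sub 1
  rw [stieltjes_outlier hσ hα] at h
  have e : σ ^ 2 / (4 * α) * (1 / α) = σ ^ 2 / (4 * α ^ 2) := by
    have : 0 < α := by linarith
    field_simp
  rw [e] at h
  exact h.congr fun t => (exp_mul_spikeResponse σ α t).symm

theorem spikeWeight_pos {σ α : ℝ} (hσ : 0 < σ) (hα : σ / 2 < α) :
    0 < 1 - σ ^ 2 / (4 * α ^ 2) := by
  have : 0 < α := by linarith
  rw [sub_pos, div_lt_one (by positivity)]
  nlinarith

theorem exp_mul_spikeResponse_mem {σ α : ℝ} (hσ : 0 < σ) (hα : σ / 2 < α) {t : ℝ} (ht : 0 ≤ t) :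
    Real.exp (-outlier σ α * t) * spikeResponse σ α t ∈
      Set.Icc (1 - σ ^ 2 / (4 * α ^ 2)) 1 := by
  have hα0 : 0 < α := by linarith
  rw [exp_mul_spikeResponse]
  constructor
  · have h := (stieltjes_sub_laplace hσ (lt_outlier hσ hα) ht).1
    rw [stieltjes_outlier hσ hα] at h
    have e : σ ^ 2 / (4 * α ^ 2) = σ ^ 2 / (4 * α) * (1 / α) := by field_simp
    rw [e]
    have := mul_le_mul_of_nonneg_left (sub_nonneg.1 h) (show 0 ≤ σ ^ 2 / (4 * α) by positivity)
    linarith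
  · have := intervalIntegral.integral_nonneg (μ := volume) ht
      (fun x (_ : x ∈ Set.Icc 0 t) => mul_nonneg (Real.exp_pos (-outlier σ α * x)).le
        (semicircleMgf_nonneg σ x))
    have := mul_nonneg (show 0 ≤ σ ^ 2 / (4 * α) by positivity) this
    linarith

theorem le_spikeResponse {σ α : ℝ} (hσ : 0 < σ) (hα : σ / 2 < α) {t : ℝ} (ht : 0 ≤ t) :
    (1 - σ ^ 2 / (4 * α ^ 2)) * Real.exp (outlier σ α * t) ≤ spikeResponse σ α t := by
  have h := (exp_mul_spikeResponse_mem hσ hα ht).1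
  rwa [neg_mul, Real.exp_neg, inv_mul_eq_div, le_div_iff₀ (Real.exp_pos _)] at h

theorem spikeResponse_le {σ α : ℝ} (hσ : 0 < σ) (hα : σ / 2 < α) {t : ℝ} (ht : 0 ≤ t) :
    spikeResponse σ α t ≤ Real.exp (outlier σ α * t) := by
  have h := (exp_mul_spikeResponse_mem hσ hα ht).2
  rwa [neg_mul, Real.exp_neg, inv_mul_eq_div, div_le_one (Real.exp_pos _)] at h

theorem spikeResponse_pos {σ α : ℝ} (hσ : 0 < σ) (hα : σ / 2 < α) {t : ℝ} (ht : 0 ≤ t) :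
    0 < spikeResponse σ α t :=
  (mul_pos (spikeWeight_pos hσ hα) (Real.exp_pos _)).trans_le (le_spikeResponse hσ hα ht)

/-- Reversing the sign of the spike turns the subtracted convolution into an added one. -/
theorem spikeResponse_neg_nonneg {σ α : ℝ} (hα : 0 < α) {t : ℝ} (ht : 0 ≤ t) :
    0 ≤ spikeResponse σ (-α) t := by
  unfold spikeResponse
  rw [show σ ^ 2 / (4 * -α) = -(σ ^ 2 / (4 * α)) by rw [mul_neg, div_neg], neg_mul,
    sub_neg_eq_add]
  exact add_nonneg (Real.exp_pos _).le (mul_nonneg (by positivity)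
    (vconv_nonneg ht (fun _ _ _ => semicircleMgf_nonneg _ _) fun _ _ _ => (Real.exp_pos _).le))

/-- The square of the propagator `m + α h ∗ ·` started from the spike, evaluated at time `t`, is
the response at time `2 t`. -/
theorem response_double {h m : ℝ → ℝ} {α : ℝ} (hh : Continuous h) (hm : Continuous m)
    (heq : ∀ t, 0 ≤ t → h t = m t + α * vconv m h t) {t : ℝ} (ht : 0 ≤ t) :
    m (2 * t) + 2 * α * (∫ x in (0 : ℝ)..t, h x * m (2 * t - x)) +
      α ^ 2 * (∫ x in (0 : ℝ)..t, ∫ w in (0 : ℝ)..t, h x * h w * m (2 * t - x - w)) =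
      h (2 * t) := by
  have hht : Continuous fun v => h (t + v) := by fun_prop
  -- The equation of `h` at time `2t - x`, with its convolution split at time `t`.
  have hinner : ∀ x, 0 ≤ x → x ≤ t → α * ∫ w in (0 : ℝ)..t, h w * m (2 * t - x - w) =
      h (2 * t - x) - m (2 * t - x) - α * vconv (fun v => h (t + v)) m (t - x) := by
    intro x _ hx
    have e1 := heq (2 * t - x) (by linarith)
    rw [vconv_comm, vconv, ← intervalIntegral.integral_add_adjacent_intervals (b := t)
      (Continuous.intervalIntegrable (by fun_prop) _ _)
      (Continuous.intervalIntegrable (by fun_prop) _ _)] at e1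
    have e2 : vconv (fun v => h (t + v)) m (t - x) =
        ∫ w in t..(2 * t - x), h w * m (2 * t - x - w) := by
      have := intervalIntegral.integral_comp_add_left (a := 0) (b := t - x)
        (fun w => h w * m (2 * t - x - w)) t
      rw [add_zero, show t + (t - x) = 2 * t - x by ring] at this
      rw [← this, vconv]
      exact intervalIntegral.integral_congr fun v _ => by ring_nf
    rw [e2]; linarith
  have hdouble : α * (∫ x in (0 : ℝ)..t, ∫ w in (0 : ℝ)..t, h x * h w * m (2 * t - x - w)) =
      (∫ x in (0 : ℝ)..t, h x * h (2 * t - x)) - (∫ x in (0 : ℝ)..t, h x * m (2 * t - x))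
        - α * vconv h (vconv (fun v => h (t + v)) m) t := by
    unfold vconv at hinner ⊢
    rw [← intervalIntegral.integral_const_mul, ← intervalIntegral.integral_const_mul,
      ← intervalIntegral.integral_sub (Continuous.intervalIntegrable (by fun_prop) _ _)
        (Continuous.intervalIntegrable (by fun_prop) _ _),
      ← intervalIntegral.integral_sub (Continuous.intervalIntegrable (by fun_prop) _ _)
        (Continuous.intervalIntegrable (by
          exact continuous_const.mul (hh.mul
            ((continuous_vconv hht hm).comp (by fun_prop : Continuous fun x => t - x)))) _ _)]
    refine intervalIntegral.integral_congr fun x hx => ?_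
    rw [Set.uIcc_of_le ht] at hx
    have := hinner x hx.1 hx.2
    simp only [mul_assoc, intervalIntegral.integral_const_mul] at this ⊢
    linear_combination h x * this
  -- Commuting the convolutions brings `h` next to `m`, where the equation replaces `α h ∗ m` by `h
  -- - m`. The integrals of `h(x) h(2t - x)` then cancel.
  have hcross : α * vconv h (vconv (fun v => h (t + v)) m) t =
      (∫ x in (0 : ℝ)..t, h x * h (2 * t - x)) - ∫ w in t..(2 * t), h w * m (2 * t - w) := by
    rw [vconv_left_comm hh hht hm ht, ← vconv_const_mul_right,
      vconv_congr ht (fun _ _ _ => rfl) (g' := fun x => h x - m x) (fun x hx _ => by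
        rw [vconv_comm h m]; linarith [heq x hx]), vconv_sub_right hht hh hm]
    congr 1
    · rw [vconv_comm, vconv]
      exact intervalIntegral.integral_congr fun v _ => by ring_nf
    · have := intervalIntegral.integral_comp_add_left (a := 0) (b := t)
        (fun w => h w * m (2 * t - w)) t
      rw [add_zero, show t + t = 2 * t by ring] at this
      rw [← this, vconv]
      exact intervalIntegral.integral_congr fun v _ => by ring_nf
  have e1 := heq (2 * t) (by linarith)
  rw [vconv_comm, vconv, ← intervalIntegral.integral_add_adjacent_intervals (b := t)
      (Continuous.intervalIntegrable (by fun_prop) _ _)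
      (Continuous.intervalIntegrable (by fun_prop) _ _)] at e1
  rw [e1]
  linear_combination α * hdouble - α * hcross

/-! ### Roots of `z = β⁻¹ S(z/2)` and the threshold. -/

theorem stieltjes_semicircle_neg {σ : ℝ} (hσ : 0 < σ) (z : ℝ) :
    stieltjes (semicircle σ) (-z) = -stieltjes (semicircle σ) z := by
  unfold stieltjes
  rw [integral_semicircle hσ, integral_semicircle hσ, ← intervalIntegral.integral_neg]
  have := intervalIntegral.integral_comp_neg (a := -σ) (b := σ)
    (fun x => 2 / (Real.pi * σ ^ 2) * √(σ ^ 2 - x ^ 2) * (1 / (-z - x)))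
  rw [neg_neg] at this
  rw [← this]
  refine intervalIntegral.integral_congr fun x _ => ?_
  simp only [neg_sq]
  rw [show -z - -x = -(z - x) by ring, div_neg]; ring

theorem sqrt_two_mul_sub_pos {σ b : ℝ} (hb : σ ^ 2 < b) : 0 < √(2 * b - σ ^ 2) :=
  Real.sqrt_pos.2 (by nlinarith)

theorem lt_div_sqrt {σ b : ℝ} (hb : σ ^ 2 < b) : σ < b / √(2 * b - σ ^ 2) := by
  rw [lt_div_iff₀ (sqrt_two_mul_sub_pos hb)]
  have hb0 : 0 < b := by nlinarith
  refine lt_of_pow_lt_pow_left₀ 2 hb0.le ?_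
  rw [mul_pow, Real.sq_sqrt (by nlinarith)]
  nlinarith [sq_pos_of_pos (sub_pos.2 hb)]

/-- The equation rearranges to `b √(w² - σ²) = (b - σ²) w`. Positivity of the left side forces `b >
σ²`, and then squaring loses nothing. -/
theorem stieltjes_root_iff {σ b w : ℝ} (hσ : 0 < σ) (hb : 0 < b) (hw : σ < w) :
    2 * w = b * stieltjes (semicircle σ) w ↔ σ ^ 2 < b ∧ w = b / √(2 * b - σ ^ 2) := by
  rw [stieltjes_semicircle hσ hw]
  have hws : 0 < w ^ 2 - σ ^ 2 := by nlinarith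
  have hd0 : 0 < √(w ^ 2 - σ ^ 2) := Real.sqrt_pos.2 hws
  have hd2 : √(w ^ 2 - σ ^ 2) ^ 2 = w ^ 2 - σ ^ 2 := Real.sq_sqrt hws.le
  have hw0 : 0 < w := hσ.trans hw
  have h1 : 2 * w = b * (2 / σ ^ 2 * (w - √(w ^ 2 - σ ^ 2))) ↔
      b * √(w ^ 2 - σ ^ 2) = (b - σ ^ 2) * w := by
    constructor
    · intro h; field_simp at h; linarith
    · intro h; field_simp; linarith
  rw [h1]
  constructor
  · intro h
    have hbσ : σ ^ 2 < b := by
      have : 0 < (b - σ ^ 2) * w := by rw [← h]; positivity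
      linarith [(pos_iff_pos_of_mul_pos this).2 hw0]
    refine ⟨hbσ, ?_⟩
    have hs := sqrt_two_mul_sub_pos hbσ
    rw [eq_div_iff hs.ne']
    refine (pow_left_inj₀ (by positivity) hb.le two_ne_zero).1 ?_
    rw [mul_pow, Real.sq_sqrt (by nlinarith)]
    have h2 : b ^ 2 * (w ^ 2 - σ ^ 2) = (b - σ ^ 2) ^ 2 * w ^ 2 := by
      rw [← hd2, ← mul_pow, h]; ring
    have : σ ^ 2 * (w ^ 2 * (2 * b - σ ^ 2)) = σ ^ 2 * b ^ 2 := by linarith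
    exact mul_left_cancel₀ (by positivity) this
  · rintro ⟨hbσ, h⟩
    have hs := sqrt_two_mul_sub_pos hbσ
    rw [eq_div_iff hs.ne'] at h
    refine (pow_left_inj₀ (by positivity)
      (mul_nonneg (by linarith) hw0.le) two_ne_zero).1 ?_
    have h2 : w ^ 2 * (2 * b - σ ^ 2) = b ^ 2 := by
      have := congrArg (· ^ 2) h
      simp only [mul_pow] at this
      rwa [Real.sq_sqrt (by nlinarith)] at this
    rw [mul_pow, hd2]
    linear_combination σ ^ 2 * h2

theorem roots_eq {σ β : ℝ} (hσ : 0 < σ) (hβ : 0 < β) (h : β < 1 / σ ^ 2) :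
    roots β σ = {2 * (β⁻¹ / √(2 * β⁻¹ - σ ^ 2)), -(2 * (β⁻¹ / √(2 * β⁻¹ - σ ^ 2)))} := by
  have hb : σ ^ 2 < β⁻¹ := by
    rwa [lt_inv_comm₀ (by positivity) hβ, ← one_div]
  have hw := lt_div_sqrt hb
  have hb0 : 0 < β⁻¹ := inv_pos.2 hβ
  ext z
  simp only [roots, Set.mem_ofPred_eq, Set.mem_insert_iff, Set.mem_singleton_iff]
  constructor
  · rintro ⟨hz, he⟩
    rcases lt_or_ge σ (z / 2) with h1 | h1
    · left
      have := ((stieltjes_root_iff hσ hb0 h1).1 (by linarith)).2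
      linarith
    · right
      have h2 : σ < -(z / 2) := by
        by_contra! h2
        exact hz ⟨by linarith, h1⟩
      have := ((stieltjes_root_iff hσ hb0 h2).1 (by
        rw [stieltjes_semicircle_neg hσ]; linarith)).2
      linarith
  · have key := (stieltjes_root_iff hσ hb0 hw).2 ⟨hb, rfl⟩
    rintro (rfl | rfl)
    · rw [mul_div_cancel_left₀ _ two_ne_zero]
      exact ⟨fun hc => absurd hc.2 (not_le.2 hw), key⟩
    · rw [neg_div, mul_div_cancel_left₀ _ two_ne_zero, stieltjes_semicircle_neg hσ]
      exact ⟨fun hc => by linarith [hc.1], by linarith⟩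

theorem roots_eq_empty {σ β : ℝ} (hσ : 0 < σ) (hβ : 0 < β) (h : ¬ β < 1 / σ ^ 2) :
    roots β σ = ∅ := by
  have hb : ¬ σ ^ 2 < β⁻¹ := by
    rwa [lt_inv_comm₀ (by positivity) hβ, ← one_div]
  have hb0 : 0 < β⁻¹ := inv_pos.2 hβ
  refine Set.eq_empty_of_forall_notMem fun z hz => ?_
  obtain ⟨hz, he⟩ := hz
  rcases lt_or_ge σ (z / 2) with h1 | h1
  · exact hb ((stieltjes_root_iff hσ hb0 h1).1 (by linarith)).1
  · have h2 : σ < -(z / 2) := by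
      by_contra! h2
      exact hz ⟨by linarith, h1⟩
    exact hb ((stieltjes_root_iff hσ hb0 h2).1 (by
      rw [stieltjes_semicircle_neg hσ]; linarith)).1

theorem isGreatest_roots {σ β : ℝ} (hσ : 0 < σ) (hβ : 0 < β) (h : β < 1 / σ ^ 2) :
    IsGreatest (roots β σ) (2 * (β⁻¹ / √(2 * β⁻¹ - σ ^ 2))) := by
  have hb0 : 0 < β⁻¹ := inv_pos.2 hβ
  rw [roots_eq hσ hβ h]
  refine ⟨by simp, ?_⟩
  have : 0 ≤ β⁻¹ / √(2 * β⁻¹ - σ ^ 2) := by positivity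
  rintro z (rfl | rfl)
  · exact le_rfl
  · linarith

theorem threshold_eq {σ β : ℝ} (hσ : 0 < σ) (hβ : 0 < β) (h : β < 1 / σ ^ 2) :
    threshold β σ = 2 * (β⁻¹ / √(2 * β⁻¹ - σ ^ 2)) := by
  rw [threshold, if_pos h, (isGreatest_roots hσ hβ h).csSup_eq]

theorem ncard_roots {σ β : ℝ} (hσ : 0 < σ) (hβ : 0 < β) (h : β < 1 / σ ^ 2) :
    (roots β σ).ncard = 2 := by
  have hb : σ ^ 2 < β⁻¹ := by
    rwa [lt_inv_comm₀ (by positivity) hβ, ← one_div]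
  have hw := lt_div_sqrt hb
  rw [roots_eq hσ hβ h, Set.ncard_pair (by linarith)]

/-- The spike strength whose outlier is the positive root. -/
theorem outlier_sqrt {σ b : ℝ} (hb : σ ^ 2 < b) :
    σ / 2 < √(b / 2 - σ ^ 2 / 4) ∧
      outlier σ √(b / 2 - σ ^ 2 / 4) = b / √(2 * b - σ ^ 2) := by
  have h1 : √(2 * b - σ ^ 2) = 2 * √(b / 2 - σ ^ 2 / 4) := by
    rw [show 2 * b - σ ^ 2 = 2 ^ 2 * (b / 2 - σ ^ 2 / 4) by ring, Real.sqrt_mul (by norm_num),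
      Real.sqrt_sq (by norm_num)]
  have h2 : √(b / 2 - σ ^ 2 / 4) ^ 2 = b / 2 - σ ^ 2 / 4 := Real.sq_sqrt (by nlinarith)
  have h3 : 0 < √(b / 2 - σ ^ 2 / 4) := Real.sqrt_pos.2 (by nlinarith)
  constructor
  · refine lt_of_pow_lt_pow_left₀ 2 h3.le ?_
    rw [h2]; nlinarith
  · rw [h1, outlier]
    generalize √(b / 2 - σ ^ 2 / 4) = r at h2 h3
    field_simp
    linarith

/-- The difference factors as `(γ - α)(4αγ - σ²)/(4αγ)`. Monotonicity beyond `σ/2` converts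
comparisons of `2λ̃` with the threshold into comparisons of spike strengths. -/
theorem outlier_lt_outlier {σ α γ : ℝ} (hσ : 0 < σ) (hα : σ / 2 < α) (h : α < γ) :
    outlier σ α < outlier σ γ := by
  have hα0 : 0 < α := by linarith
  have hγ0 : 0 < γ := by linarith
  have : outlier σ γ - outlier σ α = (γ - α) * (4 * α * γ - σ ^ 2) / (4 * α * γ) := by
    unfold outlier; field_simp; ring
  have h2 : 0 < (γ - α) * (4 * α * γ - σ ^ 2) / (4 * α * γ) :=
    div_pos (mul_pos (by linarith) (by nlinarith)) (by positivity)
  linarith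

/-- If the threshold lies below `2 λ̃`, then the noise is subcritical. -/
theorem noise_lt_of_threshold_lt {σ lam β : ℝ} (hσ : 0 < σ) (hlam : σ / 2 < lam) (hβ : 0 < β)
    (h : threshold β σ < 2 * outlier σ lam) : β⁻¹ < 2 * lam * outlier σ lam := by
  have hlam0 : 0 < lam := by linarith
  have e : 2 * lam * outlier σ lam = 2 * lam ^ 2 + σ ^ 2 / 2 := by
    unfold outlier; field_simp; ring
  rw [e]
  by_cases hc : β < 1 / σ ^ 2
  · have hb : σ ^ 2 < β⁻¹ := by
      rwa [lt_inv_comm₀ (by positivity) hβ, ← one_div]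
    obtain ⟨h1, h2⟩ := outlier_sqrt hb
    rw [threshold_eq hσ hβ hc, ← h2] at h
    have h3 : √(β⁻¹ / 2 - σ ^ 2 / 4) < lam := by
      by_contra! h3
      rcases h3.eq_or_lt with h3 | h3
      · rw [← h3] at h; exact lt_irrefl _ h
      · linarith [outlier_lt_outlier hσ hlam h3]
    rw [Real.sqrt_lt' hlam0] at h3
    linarith
  -- Without a root the noise is subcritical for every admissible `lam`: `σ² < 2 lam² + σ²/2` as
  -- soon as `lam > σ/2`.
  · have hb : β⁻¹ ≤ σ ^ 2 := by
      rw [← not_lt]; rwa [lt_inv_comm₀ (by positivity) hβ, ← one_div]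
    nlinarith

/-- The threshold must come from a root, as `2σ` lies below `2λ̃`. The witness is the spike strength
whose outlier is half that root. -/
theorem noise_of_lt_threshold {σ lam β : ℝ} (hσ : 0 < σ) (hlam : σ / 2 < lam) (hβ : 0 < β)
    (h : 2 * outlier σ lam < threshold β σ) :
    ∃ α, σ / 2 < α ∧ β⁻¹ / 2 = α ^ 2 + σ ^ 2 / 4 ∧ outlier σ lam < outlier σ α := by
  by_cases hc : β < 1 / σ ^ 2
  · have hb : σ ^ 2 < β⁻¹ := by
      rwa [lt_inv_comm₀ (by positivity) hβ, ← one_div]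
    obtain ⟨h1, h2⟩ := outlier_sqrt hb
    rw [threshold_eq hσ hβ hc, ← h2] at h
    refine ⟨_, h1, ?_, by linarith⟩
    rw [Real.sq_sqrt (by nlinarith)]; ring
  · rw [threshold, if_neg hc] at h
    linarith [lt_outlier hσ hlam]

/-! ### The growth produced by the noise alone. -/

/-- The resolvent of the noise `(α² + σ² / 4) m ∗ ·` grows like the response to a spike of
strength `α`. -/
theorem exists_resolvent {σ α : ℝ} (hσ : 0 < σ) (hα : 0 < α) :
    ∃ G : ℝ → ℝ, Continuous G ∧ (∀ t, 0 ≤ t → spikeResponse σ α t / 2 ≤ G t) ∧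
      ∀ t, 0 ≤ t → G t = 1 + (α ^ 2 + σ ^ 2 / 4) *
        vconv (vconv (fun _ => 1) (semicircleMgf σ)) G t := by
  have hm := continuous_semicircleMgf hσ
  have hp := continuous_spikeResponse hσ α
  have hn := continuous_spikeResponse hσ (-α)
  have h1c : Continuous fun _ : ℝ => (1 : ℝ) := continuous_const
  set m := semicircleMgf σ with hm_def
  -- The Laplace transform of the solution must be `1/(z - (α² + σ²/4) S)`. As `z = σ²S/4 + 1/S`,
  -- this equals `S/(1 - α²S²)`, the mean of `S/(1 - αS)` and `S/(1 + αS)`, which are the transforms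
  -- of the responses to spikes `α` and `-α`.
  set G : ℝ → ℝ := fun t => 1 / 2 * (spikeResponse σ α t + spikeResponse σ (-α) t) with hG_def
  have hG : Continuous G := by fun_prop
  have hmG : ∀ t, vconv m G t =
      1 / 2 * (vconv m (spikeResponse σ α) t + vconv m (spikeResponse σ (-α)) t) := fun t => by
    rw [hG_def, vconv_const_mul_right, vconv_add_right hm hp hn]
  have hp_eq : ∀ t, 0 ≤ t → spikeResponse σ α t = m t + α * vconv m (spikeResponse σ α) t :=
    fun t ht => spikeResponse_eq hσ hα.ne' ht
  have hn_eq : ∀ t, 0 ≤ t →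
      spikeResponse σ (-α) t = m t + -α * vconv m (spikeResponse σ (-α)) t :=
    fun t ht => spikeResponse_eq hσ (neg_ne_zero.2 hα.ne') ht
  have hG_eq : ∀ t, 0 ≤ t → G t = m t + α ^ 2 * vconv m (vconv m G) t := by
    intro t ht
    -- Subtracting the equations for `α` and `-α` gives `m ∗ G` as their difference divided by `2α`.
    have e1 : vconv m (vconv m G) t =
        vconv m (fun t => (2 * α)⁻¹ * (spikeResponse σ α t - spikeResponse σ (-α) t)) t := by
      refine vconv_congr ht (fun _ _ _ => rfl) fun x hx _ => ?_
      have := hp_eq x hx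
      have := hn_eq x hx
      rw [hmG]; field_simp; linarith
    rw [e1, vconv_const_mul_right, vconv_sub_right hm hp hn]
    have := hp_eq t ht
    have := hn_eq t ht
    have e2 : α ^ 2 * (2 * α)⁻¹ = α / 2 := by field_simp
    rw [← mul_assoc, e2]
    simp only [hG_def]; linarith
  refine ⟨G, hG, fun t ht => ?_, fun t ht => ?_⟩
  · have := spikeResponse_neg_nonneg (σ := σ) hα ht
    simp only [hG_def]; linarith
  · have hmm := continuous_vconv hm hm
    have h1m := continuous_vconv h1c hm
    have hmG' := continuous_vconv hm hG
    have hmmG := continuous_vconv hm hmG'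
    have hmq : ∀ t, 0 ≤ t → σ ^ 2 / 4 * vconv (vconv (fun _ => 1) m) m t = m t - 1 :=
      fun t ht => by
        have := semicircleMgf_eq_one_add hσ ht
        rw [vconv_assoc h1c hm hm ht]; linarith
    have e1 : vconv (vconv (fun _ => 1) m) G t = vconv (vconv (fun _ => 1) m) m t +
        α ^ 2 * vconv (vconv (fun _ => 1) m) (vconv m (vconv m G)) t := by
      rw [← vconv_const_mul_right, ← vconv_add_right h1m hm (hmmG.const_mul _)]
      exact vconv_congr ht (fun _ _ _ => rfl) fun x hx _ => hG_eq x hx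
    -- The quadratic equation of `m` replaces `(σ²/4)(1 ∗ m ∗ m)` by `m - 1`, lowering the number of
    -- convolution factors.
    have e2 : σ ^ 2 / 4 * vconv (vconv (fun _ => 1) m) (vconv m (vconv m G)) t =
        vconv m (vconv m G) t - vconv (vconv (fun _ => 1) m) G t := by
      rw [← vconv_assoc h1m hm hmG' ht, ← vconv_const_mul_left, vconv_assoc h1c hm hG ht]
      rw [vconv_congr ht (f' := fun x => m x - 1) (g' := vconv m G) (fun x hx _ => hmq x hx)
        fun _ _ _ => rfl, vconv_comm, vconv_sub_right hmG' hm h1c, vconv_comm _ m,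
        vconv_comm _ fun _ => 1]
    have e3 := hmq t ht
    have e4 := hG_eq t ht
    rw [e4]
    linear_combination -e3 - α ^ 2 * e2 - σ ^ 2 / 4 * e1

/-! ### The primitive of the moment generating function, the kernel of the energy equation. -/

theorem vconv_one_exp {z : ℝ} (hz : 0 < z) (t : ℝ) :
    vconv (fun _ => 1) (fun x => Real.exp (-z * x)) t = (1 - Real.exp (-z * t)) / z := by
  rw [vconv_one_left, intervalIntegral.integral_comp_mul_left (fun x => Real.exp x)
    (neg_ne_zero.2 hz.ne'), integral_exp, smul_eq_mul, mul_zero, Real.exp_zero]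
  field_simp
  ring

theorem tendsto_exp_neg_mul {z : ℝ} (hz : 0 < z) :
    Tendsto (fun t : ℝ => Real.exp (-z * t)) atTop (𝓝 0) :=
  Real.tendsto_exp_atBot.comp (tendsto_id.const_mul_atTop_of_neg (by linarith))

theorem exp_neg_mul_mem {z t : ℝ} (hz : 0 < z) (ht : 0 ≤ t) :
    Real.exp (-z * t) ∈ Set.Icc 0 1 :=
  ⟨(Real.exp_pos _).le, Real.exp_le_one_iff.2 (by nlinarith)⟩

/-- The primitive `∫₀ᵗ m` of the moment generating function of the semicircle law. -/
noncomputable def mgfPrimitive (σ : ℝ) : ℝ → ℝ := vconv (fun _ => 1) (semicircleMgf σ)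

@[fun_prop]
theorem continuous_mgfPrimitive {σ : ℝ} (hσ : 0 < σ) : Continuous (mgfPrimitive σ) :=
  continuous_vconv continuous_const (continuous_semicircleMgf hσ)

theorem mgfPrimitive_nonneg (σ : ℝ) {t : ℝ} (ht : 0 ≤ t) : 0 ≤ mgfPrimitive σ t :=
  vconv_nonneg ht (fun _ _ _ => zero_le_one) fun _ _ _ => semicircleMgf_nonneg _ _

theorem exp_mul_mgfPrimitive (σ z t : ℝ) : Real.exp (-z * t) * mgfPrimitive σ t =
    vconv (fun x => Real.exp (-z * x) * semicircleMgf σ x) (fun x => Real.exp (-z * x)) t := by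
  rw [mgfPrimitive, exp_mul_vconv, vconv_comm]; simp

theorem tendsto_exp_mul_mgfPrimitive {σ z : ℝ} (hσ : 0 < σ) (hz : σ < z) :
    Tendsto (fun t => Real.exp (-z * t) * mgfPrimitive σ t) atTop (𝓝 0) := by
  have hm := continuous_semicircleMgf hσ
  have hz0 := hσ.trans hz
  have h := tendsto_vconv (k := fun x => Real.exp (-z * x) * semicircleMgf σ x)
    (x := fun x => Real.exp (-z * x)) (B := 1) (by fun_prop)
    (by fun_prop) (integrableOn_laplace_semicircleMgf hσ hz) (fun u hu => by
      rw [abs_of_nonneg (exp_neg_mul_mem hz0 hu).1]; exact (exp_neg_mul_mem hz0 hu).2)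
    (tendsto_exp_neg_mul hz0)
  rw [mul_zero] at h
  exact h.congr fun t => (exp_mul_mgfPrimitive σ z t).symm

theorem exp_mul_mgfPrimitive_le {σ z : ℝ} (hσ : 0 < σ) (hz : σ < z) {t : ℝ} (ht : 0 ≤ t) :
    Real.exp (-z * t) * mgfPrimitive σ t ≤ stieltjes (semicircle σ) z := by
  have hm := continuous_semicircleMgf hσ
  have hz0 := hσ.trans hz
  rw [exp_mul_mgfPrimitive, ← integral_laplace_semicircleMgf hσ hz]
  refine (le_abs_self _).trans ((abs_vconv_le (B := 1) (by fun_prop)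
    (by fun_prop) (fun u _ => mul_nonneg (Real.exp_pos _).le (semicircleMgf_nonneg _ _))
    (integrableOn_laplace_semicircleMgf hσ hz) ht fun u hu => ?_).trans_eq (mul_one _))
  rw [abs_of_nonneg (exp_neg_mul_mem hz0 hu).1]; exact (exp_neg_mul_mem hz0 hu).2

/-- The truncated transform is the convolution of the integrable `exp(-z x) m(x)` with `1 ∗ exp(-z
·)`, which tends to `1/z`. -/
theorem tendsto_laplace_mgfPrimitive {σ z : ℝ} (hσ : 0 < σ) (hz : σ < z) :
    Tendsto (fun t => ∫ x in (0 : ℝ)..t, Real.exp (-z * x) * mgfPrimitive σ x) atTop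
      (𝓝 (stieltjes (semicircle σ) z / z)) := by
  have hm := continuous_semicircleMgf hσ
  have hz0 := hσ.trans hz
  have hk : Continuous fun x => Real.exp (-z * x) * semicircleMgf σ x := by fun_prop
  have hE : Continuous fun x : ℝ => Real.exp (-z * x) := by fun_prop
  have hlim : Tendsto (vconv (fun _ => 1) fun x => Real.exp (-z * x)) atTop (𝓝 (1 / z)) := by
    simp_rw [funext (vconv_one_exp hz0)]
    simpa using ((tendsto_exp_neg_mul hz0).const_sub 1).div_const z
  have h := tendsto_vconv (B := 1 / z) hk (continuous_vconv continuous_const hE)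
    (integrableOn_laplace_semicircleMgf hσ hz) (fun u hu => by
      have := exp_neg_mul_mem hz0 hu
      rw [vconv_one_exp hz0, abs_of_nonneg (div_nonneg (by linarith [this.2]) hz0.le)]
      exact div_le_div_of_nonneg_right (by linarith [this.1]) hz0.le) hlim
  rw [integral_laplace_semicircleMgf hσ hz, mul_one_div] at h
  refine h.congr' ((eventually_ge_atTop 0).mono fun t ht => ?_)
  simp_rw [exp_mul_mgfPrimitive]
  rw [← vconv_one_left, vconv_left_comm hk continuous_const hE ht]

theorem integrableOn_laplace_mgfPrimitive {σ z : ℝ} (hσ : 0 < σ) (hz : σ < z) :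
    IntegrableOn (fun x => Real.exp (-z * x) * mgfPrimitive σ x) (Set.Ioi 0) := by
  have hm := continuous_mgfPrimitive hσ
  refine integrableOn_Ioi_of_intervalIntegral_norm_tendsto _ 0
    (fun t => (Continuous.integrableOn_Icc (by fun_prop)).mono_set Set.Ioc_subset_Icc_self)
    tendsto_id (l := atTop) ((tendsto_laplace_mgfPrimitive hσ hz).congr' ?_)
  refine (eventually_ge_atTop 0).mono fun t ht =>
    intervalIntegral.integral_congr fun x hx => ?_
  rw [Set.uIcc_of_le ht] at hx
  simp only [Real.norm_eq_abs]
  rw [abs_of_nonneg (mul_nonneg (Real.exp_pos _).le (mgfPrimitive_nonneg σ hx.1))]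

theorem integral_laplace_mgfPrimitive {σ z : ℝ} (hσ : 0 < σ) (hz : σ < z) :
    ∫ x in Set.Ioi 0, Real.exp (-z * x) * mgfPrimitive σ x = stieltjes (semicircle σ) z / z :=
  tendsto_nhds_unique (intervalIntegral_tendsto_integral_Ioi 0
    (integrableOn_laplace_mgfPrimitive hσ hz) tendsto_id) (tendsto_laplace_mgfPrimitive hσ hz)

/-! ### The energy equation: solvability, positivity and growth. -/

/-- The contribution of the initial condition to the energy. -/
noncomputable def signal (σ lam ρ t : ℝ) : ℝ :=
  (1 - ρ ^ 2) * semicircleMgf σ t + ρ ^ 2 * spikeResponse σ lam t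

theorem continuous_signal {σ : ℝ} (hσ : 0 < σ) (lam ρ : ℝ) : Continuous (signal σ lam ρ) := by
  have := continuous_semicircleMgf hσ
  have := continuous_spikeResponse hσ lam
  unfold signal
  fun_prop

theorem signal_pos {σ lam ρ : ℝ} (hσ : 0 < σ) (hlam : σ / 2 < lam) (hρ : ρ ∈ Set.Icc (0 : ℝ) 1)
    {t : ℝ} (ht : 0 ≤ t) : 0 < signal σ lam ρ t := by
  have h1 := one_le_semicircleMgf hσ ht
  have h2 := spikeResponse_pos hσ hlam ht
  have h3 : ρ ^ 2 ≤ 1 := pow_le_one₀ hρ.1 hρ.2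
  unfold signal
  rcases h3.eq_or_lt with h | h
  · rw [h]; simpa using h2
  · exact add_pos_of_pos_of_nonneg (mul_pos (by linarith) (by linarith))
      (mul_nonneg (sq_nonneg _) h2.le)

theorem signal_le {σ lam ρ : ℝ} (hσ : 0 < σ) (hlam : σ / 2 < lam) (hρ : ρ ∈ Set.Icc (0 : ℝ) 1)
    {t : ℝ} (ht : 0 ≤ t) : signal σ lam ρ t ≤ Real.exp (outlier σ lam * t) := by
  have h1 : semicircleMgf σ t ≤ Real.exp (outlier σ lam * t) :=
    (semicircleMgf_le hσ ht).trans (Real.exp_le_exp.2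
      (mul_le_mul_of_nonneg_right (lt_outlier hσ hlam).le ht))
  have h2 := spikeResponse_le hσ hlam ht
  have h3 : ρ ^ 2 ≤ 1 := pow_le_one₀ hρ.1 hρ.2
  unfold signal
  nlinarith [mul_le_mul_of_nonneg_left h1 (sub_nonneg.2 h3),
    mul_le_mul_of_nonneg_left h2 (sq_nonneg ρ)]

theorem tendsto_exp_mul_signal {σ lam : ℝ} (ρ : ℝ) (hσ : 0 < σ) (hlam : σ / 2 < lam) :
    Tendsto (fun t => Real.exp (-outlier σ lam * t) * signal σ lam ρ t) atTop
      (𝓝 (ρ ^ 2 * (1 - σ ^ 2 / (4 * lam ^ 2)))) := by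
  have hlt := lt_outlier hσ hlam
  have h1 : Tendsto (fun t => Real.exp (-outlier σ lam * t) * semicircleMgf σ t) atTop (𝓝 0) := by
    refine squeeze_zero' (Eventually.of_forall fun t =>
      mul_nonneg (Real.exp_pos _).le (semicircleMgf_nonneg _ _))
      ((eventually_ge_atTop 0).mono fun t ht => ?_)
      (tendsto_exp_neg_mul (sub_pos.2 hlt))
    calc _ ≤ Real.exp (-outlier σ lam * t) * Real.exp (σ * t) :=
          mul_le_mul_of_nonneg_left (semicircleMgf_le hσ ht) (Real.exp_pos _).le
      _ = _ := by rw [← Real.exp_add]; ring_nf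
  have h := (h1.const_mul (1 - ρ ^ 2)).add
    ((tendsto_exp_mul_spikeResponse hσ hlam).const_mul (ρ ^ 2))
  rw [mul_zero, zero_add] at h
  exact h.congr fun t => by unfold signal; ring

/-- The linear Volterra equation `p = Q + (b / 2) (1 ∗ m + 1 ∗ m ∗ p)` for the (rescaled and
unnormalized) energy `p`. -/
structure IsEnergy (σ lam b ρ : ℝ) (p : ℝ → ℝ) : Prop where
  continuous : Continuous p
  eq : ∀ t, 0 ≤ t → p t = signal σ lam ρ t + b / 2 * mgfPrimitive σ t +
    vconv (fun u => b / 2 * mgfPrimitive σ u) p t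

theorem IsEnergy.unique {σ lam b ρ : ℝ} (hσ : 0 < σ) {p p' : ℝ → ℝ} (hp : IsEnergy σ lam b ρ p)
    (hp' : IsEnergy σ lam b ρ p') : ∀ t, 0 ≤ t → p t = p' t :=
  volterra_unique ((continuous_mgfPrimitive hσ).const_mul _) hp.continuous hp'.continuous
    hp.eq hp'.eq

theorem IsEnergy.pos {σ lam b ρ : ℝ} {p : ℝ → ℝ} (hp : IsEnergy σ lam b ρ p) (hσ : 0 < σ)
    (hlam : σ / 2 < lam) (hb : 0 < b) (hρ : ρ ∈ Set.Icc (0 : ℝ) 1) {t : ℝ} (ht : 0 ≤ t) :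
    0 < p t := by
  have hk0 : ∀ u, 0 ≤ u → 0 ≤ b / 2 * mgfPrimitive σ u := fun u hu =>
    mul_nonneg (by positivity) (mgfPrimitive_nonneg σ hu)
  have hnn := volterra_nonneg ((continuous_mgfPrimitive hσ).const_mul _) hp.continuous hk0
    (fun t ht => add_nonneg (signal_pos hσ hlam hρ ht).le (hk0 t ht)) hp.eq
  have h1 := signal_pos hσ hlam hρ ht
  have h2 := hk0 t ht
  have h3 := vconv_nonneg ht (fun u hu _ => hk0 u hu) fun u hu _ => hnn u hu
  rw [hp.eq t ht]
  linarith

/-- Weighted by `exp(-outlier σ α · t)`, the kernel has mass `b/(2α · outlier σ α) < 1`, because the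
Stieltjes transform at the outlier is `1/α`. The condition `lam ≤ α` keeps the weighted signal
bounded, and the noise part of the forcing drops out in the limit. -/
theorem exists_isEnergy_tendsto {σ lam b ρ α : ℝ} (hσ : 0 < σ) (hlam : σ / 2 < lam) (hb : 0 < b)
    (hρ : ρ ∈ Set.Icc (0 : ℝ) 1) (hα : lam ≤ α) (hbα : b < 2 * α * outlier σ α) :
    ∃ p, IsEnergy σ lam b ρ p ∧
      ∀ L, Tendsto (fun t => Real.exp (-outlier σ α * t) * signal σ lam ρ t) atTop (𝓝 L) →
        Tendsto (fun t => Real.exp (-outlier σ α * t) * p t) atTop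
          (𝓝 (L / (1 - b / (2 * α * outlier σ α)))) := by
  have hα' : σ / 2 < α := hlam.trans_le hα
  have hα0 : 0 < α := by linarith
  have hlt := lt_outlier hσ hα'
  have hz0 := hσ.trans hlt
  have hle : outlier σ lam ≤ outlier σ α := by
    rcases hα.eq_or_lt with rfl | h
    · exact le_rfl
    · exact (outlier_lt_outlier hσ hlam h).le
  have hcomm : ∀ u, Real.exp (-outlier σ α * u) * (b / 2 * mgfPrimitive σ u) =
      b / 2 * (Real.exp (-outlier σ α * u) * mgfPrimitive σ u) := fun u => by ring
  have hmass : ∫ u in Set.Ioi 0, Real.exp (-outlier σ α * u) * (b / 2 * mgfPrimitive σ u) =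
      b / (2 * α * outlier σ α) := by
    simp_rw [hcomm]
    rw [integral_const_mul, integral_laplace_mgfPrimitive hσ hlt, stieltjes_outlier hσ hα']
    field_simp
  have hk := (continuous_mgfPrimitive hσ).const_mul (b / 2)
  have hs := continuous_signal hσ lam ρ
  obtain ⟨p, hp, hp_eq, hlim⟩ := volterra_exists_exp
    (F := fun t => signal σ lam ρ t + b / 2 * mgfPrimitive σ t)
    (k := fun u => b / 2 * mgfPrimitive σ u)
    (C := 1 + b / 2 * stieltjes (semicircle σ) (outlier σ α)) (outlier σ α)
    (by fun_prop) hk (fun u hu => mul_nonneg (by positivity) (mgfPrimitive_nonneg σ hu))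
    (by simp_rw [hcomm]; exact (integrableOn_laplace_mgfPrimitive hσ hlt).const_mul _)
    (by rw [hmass, div_lt_one (by positivity)]; exact hbα)
    (fun t ht => by
      have h1 := (signal_pos hσ hlam hρ ht).le
      have h2 := mgfPrimitive_nonneg σ ht
      rw [abs_of_nonneg (by positivity), mul_add, hcomm]
      refine add_le_add ?_ (mul_le_mul_of_nonneg_left
        (exp_mul_mgfPrimitive_le hσ hlt ht) (by positivity))
      calc _ ≤ Real.exp (-outlier σ α * t) * Real.exp (outlier σ lam * t) :=
            mul_le_mul_of_nonneg_left (signal_le hσ hlam hρ ht) (Real.exp_pos _).le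
        _ ≤ 1 := by
            rw [← Real.exp_add, Real.exp_le_one_iff]
            nlinarith [mul_le_mul_of_nonneg_right hle ht])
  refine ⟨p, ⟨hp, hp_eq⟩, fun L hL => ?_⟩
  rw [hmass] at hlim
  refine hlim L ?_
  have h := hL.add ((tendsto_exp_mul_mgfPrimitive hσ hlt).const_mul (b / 2))
  rw [mul_zero, add_zero] at h
  exact h.congr fun t => by ring

/-- Whatever the noise, a large enough weight makes the kernel a contraction; `lam + b + 1` is such
a strength, since its outlier exceeds it. -/
theorem exists_isEnergy {σ lam b ρ : ℝ} (hσ : 0 < σ) (hlam : σ / 2 < lam) (hb : 0 < b)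
    (hρ : ρ ∈ Set.Icc (0 : ℝ) 1) : ∃ p, IsEnergy σ lam b ρ p := by
  have hlam0 : 0 < lam := by linarith
  have h1 : σ / 2 < lam + b + 1 := by linarith
  have h2 : lam + b + 1 < outlier σ (lam + b + 1) := by
    unfold outlier
    have : 0 < σ ^ 2 / (4 * (lam + b + 1)) := by positivity
    linarith
  obtain ⟨p, hp, -⟩ := exists_isEnergy_tendsto (α := lam + b + 1) hσ hlam hb hρ (by linarith)
    (by nlinarith)
  exact ⟨p, hp⟩

theorem IsEnergy.tendsto {σ lam b ρ : ℝ} {p : ℝ → ℝ} (hp : IsEnergy σ lam b ρ p) (hσ : 0 < σ)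
    (hlam : σ / 2 < lam) (hb : 0 < b) (hρ : ρ ∈ Set.Icc (0 : ℝ) 1)
    (hbl : b < 2 * lam * outlier σ lam) :
    Tendsto (fun t => Real.exp (-outlier σ lam * t) * p t) atTop
      (𝓝 (ρ ^ 2 * (1 - σ ^ 2 / (4 * lam ^ 2)) / (1 - b / (2 * lam * outlier σ lam)))) := by
  obtain ⟨p', hp', hlim⟩ := exists_isEnergy_tendsto hσ hlam hb hρ le_rfl hbl
  refine (hlim _ (tendsto_exp_mul_signal ρ hσ hlam)).congr'
    ((eventually_ge_atTop 0).mono fun t ht => ?_)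
  rw [hp'.unique hσ hp t ht]

/-- The squared inverse decay, `1 + ∫₀ᵗ p`, extended to an even function. -/
noncomputable def growth (p : ℝ → ℝ) (t : ℝ) : ℝ := 1 + ∫ x in (0 : ℝ)..|t|, p x

theorem continuous_growth {p : ℝ → ℝ} (hp : Continuous p) : Continuous (growth p) := by
  unfold growth
  exact continuous_const.add (intervalIntegral.continuous_parametric_intervalIntegral_of_continuous
    (f := fun _ => p) (by fun_prop) continuous_abs)

theorem growth_eq {p : ℝ → ℝ} {t : ℝ} (ht : 0 ≤ t) : growth p t = 1 + vconv (fun _ => 1) p t := by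
  rw [growth, abs_of_nonneg ht, vconv_one_left]

theorem one_le_growth {p : ℝ → ℝ} (hp : ∀ t, 0 ≤ t → 0 ≤ p t) (t : ℝ) : 1 ≤ growth p t := by
  have := intervalIntegral.integral_nonneg (μ := volume) (abs_nonneg t)
    fun x (hx : x ∈ Set.Icc 0 |t|) => hp x hx.1
  unfold growth
  linarith

/-- `1 ∗ m + 1 ∗ m ∗ p = m ∗ (1 + 1 ∗ p)`. -/
theorem mgfPrimitive_add_vconv {σ : ℝ} (hσ : 0 < σ) {p Y : ℝ → ℝ} (hp : Continuous p)
    (hY : ∀ t, 0 ≤ t → Y t = 1 + vconv (fun _ => 1) p t) {t : ℝ} (ht : 0 ≤ t) :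
    mgfPrimitive σ t + vconv (mgfPrimitive σ) p t = vconv (semicircleMgf σ) Y t := by
  have hm := continuous_semicircleMgf hσ
  have h1 : Continuous fun _ : ℝ => (1 : ℝ) := continuous_const
  rw [vconv_congr ht (fun _ _ _ => rfl) (fun x hx _ => hY x hx),
    vconv_add_right hm h1 (continuous_vconv h1 hp), mgfPrimitive, vconv_comm,
    vconv_assoc h1 hm hp ht, vconv_left_comm h1 hm hp ht]

theorem IsEnergy.eq_growth {σ lam b ρ : ℝ} {p : ℝ → ℝ} (hp : IsEnergy σ lam b ρ p) (hσ : 0 < σ)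
    {t : ℝ} (ht : 0 ≤ t) :
    p t = signal σ lam ρ t + b / 2 * vconv (semicircleMgf σ) (growth p) t := by
  rw [← mgfPrimitive_add_vconv hσ hp.continuous (fun _ => growth_eq) ht, hp.eq t ht,
    vconv_const_mul_left]
  ring

theorem isEnergy_of_eq {σ lam b ρ : ℝ} {p Y : ℝ → ℝ} (hσ : 0 < σ) (hp : Continuous p)
    (hY : ∀ t, 0 ≤ t → Y t = 1 + vconv (fun _ => 1) p t)
    (h : ∀ t, 0 ≤ t → p t = signal σ lam ρ t + b / 2 * vconv (semicircleMgf σ) Y t) :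
    IsEnergy σ lam b ρ p := by
  refine ⟨hp, fun t ht => ?_⟩
  rw [h t ht, ← mgfPrimitive_add_vconv hσ hp hY ht, vconv_const_mul_left]
  ring

/-- `growth p` and the resolvent satisfy Volterra equations with the same kernel, and the forcing of
`growth p` is larger by the primitive of the positive signal. The comparison holds by positivity. -/
theorem IsEnergy.le_growth {σ lam b ρ α : ℝ} {p : ℝ → ℝ} (hp : IsEnergy σ lam b ρ p) (hσ : 0 < σ)
    (hlam : σ / 2 < lam) (hρ : ρ ∈ Set.Icc (0 : ℝ) 1) (hα : σ / 2 < α)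
    (hbα : b / 2 = α ^ 2 + σ ^ 2 / 4) {t : ℝ} (ht : 0 ≤ t) :
    (1 - σ ^ 2 / (4 * α ^ 2)) * Real.exp (outlier σ α * t) / 2 ≤ growth p t := by
  have hα0 : 0 < α := by linarith
  have hb : 0 < b := by nlinarith
  obtain ⟨G, hG, hle, hG_eq⟩ := exists_resolvent hσ hα0
  have hm := continuous_semicircleMgf hσ
  have h1 : Continuous fun _ : ℝ => (1 : ℝ) := continuous_const
  have hs := continuous_signal hσ lam ρ
  have hY := continuous_growth hp.continuous
  have hk := (continuous_mgfPrimitive hσ).const_mul (b / 2)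
  have hY_eq : ∀ t, 0 ≤ t → growth p t = 1 + vconv (fun _ => 1) (signal σ lam ρ) t +
      b / 2 * vconv (mgfPrimitive σ) (growth p) t := by
    intro t ht
    rw [growth_eq ht, vconv_congr ht (fun _ _ _ => rfl) (fun x hx _ => hp.eq_growth hσ hx),
      vconv_add_right h1 hs ((continuous_vconv hm hY).const_mul _), vconv_const_mul_right,
      mgfPrimitive, vconv_assoc h1 hm hY ht]
    ring
  have h := volterra_nonneg (F := vconv (fun _ => 1) (signal σ lam ρ))
    (x := fun t => growth p t - G t) hk (hY.sub hG)
    (fun u hu => mul_nonneg (by positivity) (mgfPrimitive_nonneg σ hu))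
    (fun t ht => vconv_nonneg ht (fun _ _ _ => zero_le_one)
      fun u hu _ => (signal_pos hσ hlam hρ hu).le) (fun t ht => by
      have e : G t = 1 + (α ^ 2 + σ ^ 2 / 4) * vconv (mgfPrimitive σ) G t := hG_eq t ht
      rw [vconv_sub_right hk hY hG, vconv_const_mul_left, vconv_const_mul_left, hY_eq t ht, e, hbα]
      ring) t ht
  have h2 := hle t ht
  have h3 := le_spikeResponse hσ hα ht
  linarith

theorem IsEnergy.le {σ lam b ρ α : ℝ} {p : ℝ → ℝ} (hp : IsEnergy σ lam b ρ p) (hσ : 0 < σ)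
    (hlam : σ / 2 < lam) (hρ : ρ ∈ Set.Icc (0 : ℝ) 1) (hα : σ / 2 < α)
    (hbα : b / 2 = α ^ 2 + σ ^ 2 / 4) {t : ℝ} (ht : 1 ≤ t) :
    b / 4 * (1 - σ ^ 2 / (4 * α ^ 2)) * Real.exp (outlier σ α * (t - 1)) ≤ p t := by
  have hb : 0 < b := by nlinarith
  have ht0 : 0 ≤ t := by linarith
  have hm := continuous_semicircleMgf hσ
  have hY := continuous_growth hp.continuous
  have hz0 := hσ.trans (lt_outlier hσ hα)
  have hc := spikeWeight_pos hσ hα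
  have hg : ∀ u, 0 ≤ u → 0 ≤ growth p u := fun u _ => zero_le_one.trans
    (one_le_growth (fun t ht => (hp.pos hσ hlam hb hρ ht).le) u)
  -- One unit of time of the convolution suffices: there `m ≥ 1`, and `growth p` is bounded below by
  -- its exponential bound at time `t - 1`.
  have h1 : (1 - σ ^ 2 / (4 * α ^ 2)) * Real.exp (outlier σ α * (t - 1)) / 2 ≤
      ∫ x in (0 : ℝ)..1, semicircleMgf σ x * growth p (t - x) := by
    have : (1 - σ ^ 2 / (4 * α ^ 2)) * Real.exp (outlier σ α * (t - 1)) / 2 =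
        ∫ _ in (0 : ℝ)..1, (1 - σ ^ 2 / (4 * α ^ 2)) * Real.exp (outlier σ α * (t - 1)) / 2 := by
      simp
    rw [this]
    refine intervalIntegral.integral_mono_on zero_le_one intervalIntegrable_const
      (Continuous.intervalIntegrable (by fun_prop) _ _) fun x hx => ?_
    have h2 := hp.le_growth hσ hlam hρ hα hbα (t := t - x) (by linarith [hx.2])
    have h3 : Real.exp (outlier σ α * (t - 1)) ≤ Real.exp (outlier σ α * (t - x)) :=
      Real.exp_le_exp.2 (mul_le_mul_of_nonneg_left (by linarith [hx.2]) hz0.le)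
    have h4 := mul_le_mul_of_nonneg_left h3 hc.le
    have h5 := mul_le_mul_of_nonneg_right (one_le_semicircleMgf hσ hx.1)
      (hg (t - x) (by linarith [hx.2]))
    linarith
  have h2 : ∫ x in (0 : ℝ)..1, semicircleMgf σ x * growth p (t - x) ≤
      vconv (semicircleMgf σ) (growth p) t := by
    rw [vconv, ← intervalIntegral.integral_add_adjacent_intervals (a := 0) (b := 1) (c := t)
      (Continuous.intervalIntegrable (by fun_prop) _ _)
      (Continuous.intervalIntegrable (by fun_prop) _ _)]
    have := intervalIntegral.integral_nonneg (μ := volume) ht fun x (hx : x ∈ Set.Icc 1 t) =>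
      mul_nonneg (semicircleMgf_nonneg σ x) (hg (t - x) (by linarith [hx.2]))
    linarith
  have h3 := mul_le_mul_of_nonneg_left (h1.trans h2) (show 0 ≤ b / 2 by positivity)
  have h4 := signal_pos hσ hlam hρ ht0
  rw [hp.eq_growth hσ ht0]
  linarith

/-! ### Expectations under the limiting law. -/

instance (σ : ℝ) : SFinite (semicircle σ) := by unfold semicircle; infer_instance

theorem IsInitialLaw.sq_fst {lam ρ : ℝ} {ν : Measure (ℝ × ℝ)} (hν : IsInitialLaw lam ρ ν)
    (hlam : 0 < lam) : ∫ p, p.1 ^ 2 ∂ν = lam := by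
  have h1 : ∫ x, x ^ 2 ∂(ν.map Prod.fst) = ∫ p, p.1 ^ 2 ∂ν :=
    integral_map (by fun_prop) (by fun_prop)
  rw [← h1, hν.map_fst]
  have h2 := variance_id_gaussianReal (μ := 0) (v := lam.toNNReal)
  rw [variance_of_integral_eq_zero (by fun_prop) (by simp)] at h2
  simpa [hlam.le] using h2

section Expectations

variable {lam ρ σ : ℝ} {ν : Measure (ℝ × ℝ)}

theorem integral_limitLaw_mul (hν : IsInitialLaw lam ρ ν) (f : ℝ × ℝ → ℝ) (t : ℝ) :
    ∫ p, f p.1 * Real.exp (p.2 * t) ∂limitLaw ν (semicircle σ) =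
      (∫ p, f p ∂ν) * semicircleMgf σ t :=
  have := hν.isProbabilityMeasure
  integral_prod_mul f fun x => Real.exp (x * t)

theorem integral_limitLaw_exp (hν : IsInitialLaw lam ρ ν) (t : ℝ) :
    ∫ p, Real.exp (p.2 * t) ∂limitLaw ν (semicircle σ) = semicircleMgf σ t := by
  have := hν.isProbabilityMeasure
  simpa using integral_limitLaw_mul (σ := σ) hν (fun _ => 1) t

theorem integral_limitLaw_cross (hν : IsInitialLaw lam ρ ν) (t : ℝ) :
    ∫ p, Real.exp (p.2 * t) * p.1.2 * p.1.1 ∂limitLaw ν (semicircle σ) =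
      ρ * √lam * semicircleMgf σ t := by
  rw [← hν.snd_mul_fst, ← integral_limitLaw_mul hν fun p => p.2 * p.1]
  exact integral_congr_ae (ae_of_all _ fun p => by ring)

theorem integral_limitLaw_sq_fst (hν : IsInitialLaw lam ρ ν) (hlam : 0 < lam) (t : ℝ) :
    ∫ p, Real.exp (p.2 * t) * p.1.1 ^ 2 ∂limitLaw ν (semicircle σ) =
      lam * semicircleMgf σ t := by
  conv_rhs => rw [← hν.sq_fst hlam]
  rw [← integral_limitLaw_mul hν fun p => p.1 ^ 2]
  exact integral_congr_ae (ae_of_all _ fun p => by ring)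

theorem integral_limitLaw_sq_snd (hν : IsInitialLaw lam ρ ν) (t : ℝ) :
    ∫ p, Real.exp (p.2 * t) * p.1.2 ^ 2 ∂limitLaw ν (semicircle σ) = semicircleMgf σ t := by
  rw [← one_mul (semicircleMgf σ t), ← hν.sq_snd, ← integral_limitLaw_mul hν fun p => p.2 ^ 2]
  exact integral_congr_ae (ae_of_all _ fun p => by ring)

end Expectations

/-! ### Factoring the decay out of the system. -/

theorem decay_quadratic (K : ℝ → ℝ → ℝ) (r t : ℝ) :
    decay (fun x => x ^ 2 / 2) K r t = Real.exp (-∫ w in r..t, K w w) := by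
  unfold decay
  congr 2
  refine intervalIntegral.integral_congr fun w _ => ?_
  have : HasDerivAt (fun x : ℝ => x ^ 2 / 2) (K w w) (K w w) := by
    convert! (hasDerivAt_pow 2 (K w w)).div_const 2 using 1
    simp
  exact this.deriv

/-- The decay factors through its values from time `0`. -/
theorem decay_eq_div {K : ℝ → ℝ → ℝ} {A : ℝ → ℝ} (hA : Continuous A)
    (h : ∀ w, 0 ≤ w → K w w = A w) {r t : ℝ} (hr : 0 ≤ r) (ht : 0 ≤ t) :
    decay (fun x => x ^ 2 / 2) K r t =
      Real.exp (-∫ w in (0 : ℝ)..t, A w) / Real.exp (-∫ w in (0 : ℝ)..r, A w) := by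
  rw [decay_quadratic, ← Real.exp_sub]
  have h1 : ∫ w in r..t, K w w = ∫ w in r..t, A w :=
    intervalIntegral.integral_congr fun w hw => h w ((le_min hr ht).trans hw.1)
  rw [h1, ← intervalIntegral.integral_interval_sub_left (hA.intervalIntegrable _ _)
    (hA.intervalIntegrable _ _)]
  congr 1; ring

/-- The covariance with the decay factored out; `y` is the squared inverse decay. -/
noncomputable def reducedCov (σ lam b ρ : ℝ) (y : ℝ → ℝ) (t s : ℝ) : ℝ :=
  b * (∫ r in (0 : ℝ)..(min s t), y r * semicircleMgf σ (t + s - 2 * r))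
    + semicircleMgf σ (t + s)
    + ρ ^ 2 * lam * (∫ r in (0 : ℝ)..s, spikeResponse σ lam r * semicircleMgf σ (t + s - r))
    + ρ ^ 2 * lam * (∫ r in (0 : ℝ)..t, spikeResponse σ lam r * semicircleMgf σ (t + s - r))
    + ρ ^ 2 * lam ^ 2 * (∫ r₁ in (0 : ℝ)..t, ∫ r₂ in (0 : ℝ)..s,
        spikeResponse σ lam r₁ * spikeResponse σ lam r₂ * semicircleMgf σ (t + s - r₁ - r₂))

theorem continuous_reducedCov {σ : ℝ} (hσ : 0 < σ) (lam b ρ : ℝ) {y : ℝ → ℝ} (hy : Continuous y) :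
    Continuous fun q : ℝ × ℝ => reducedCov σ lam b ρ y q.1 q.2 := by
  have hm := continuous_semicircleMgf hσ
  have hh := continuous_spikeResponse hσ lam
  have c1 : Continuous fun q : ℝ × ℝ =>
      ∫ r in (0 : ℝ)..(min q.2 q.1), y r * semicircleMgf σ (q.1 + q.2 - 2 * r) :=
    intervalIntegral.continuous_parametric_intervalIntegral_of_continuous
      (f := fun (q : ℝ × ℝ) r => y r * semicircleMgf σ (q.1 + q.2 - 2 * r)) (by fun_prop)
      (by fun_prop)
  have c2 : Continuous fun q : ℝ × ℝ =>
      ∫ r in (0 : ℝ)..q.2, spikeResponse σ lam r * semicircleMgf σ (q.1 + q.2 - r) :=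
    intervalIntegral.continuous_parametric_intervalIntegral_of_continuous
      (f := fun (q : ℝ × ℝ) r => spikeResponse σ lam r * semicircleMgf σ (q.1 + q.2 - r))
      (by fun_prop) (by fun_prop)
  have c3 : Continuous fun q : ℝ × ℝ =>
      ∫ r in (0 : ℝ)..q.1, spikeResponse σ lam r * semicircleMgf σ (q.1 + q.2 - r) :=
    intervalIntegral.continuous_parametric_intervalIntegral_of_continuous
      (f := fun (q : ℝ × ℝ) r => spikeResponse σ lam r * semicircleMgf σ (q.1 + q.2 - r))
      (by fun_prop) (by fun_prop)
  have c4 : Continuous fun x : (ℝ × ℝ) × ℝ => ∫ r₂ in (0 : ℝ)..x.1.2,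
      spikeResponse σ lam x.2 * spikeResponse σ lam r₂ *
        semicircleMgf σ (x.1.1 + x.1.2 - x.2 - r₂) :=
    intervalIntegral.continuous_parametric_intervalIntegral_of_continuous
      (f := fun (x : (ℝ × ℝ) × ℝ) r₂ => spikeResponse σ lam x.2 * spikeResponse σ lam r₂ *
        semicircleMgf σ (x.1.1 + x.1.2 - x.2 - r₂)) (by fun_prop) (by fun_prop)
  have c5 : Continuous fun q : ℝ × ℝ => ∫ r₁ in (0 : ℝ)..q.1, ∫ r₂ in (0 : ℝ)..q.2,
      spikeResponse σ lam r₁ * spikeResponse σ lam r₂ *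
        semicircleMgf σ (q.1 + q.2 - r₁ - r₂) :=
    intervalIntegral.continuous_parametric_intervalIntegral_of_continuous
      (f := fun (q : ℝ × ℝ) r₁ => ∫ r₂ in (0 : ℝ)..q.2,
        spikeResponse σ lam r₁ * spikeResponse σ lam r₂ *
        semicircleMgf σ (q.1 + q.2 - r₁ - r₂)) c4 (by fun_prop)
  unfold reducedCov
  fun_prop

/-- The terms from the initial condition and the response combine by `response_double`: `m(2t)` with
weight `1 - ρ²` and the response at time `2t` with weight `ρ²`. -/
theorem reducedCov_diag {σ lam : ℝ} (b ρ : ℝ) (hσ : 0 < σ) (hlam : 0 < lam) (y : ℝ → ℝ) {t : ℝ}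
    (ht : 0 ≤ t) : reducedCov σ lam b ρ y t t = signal σ lam ρ (2 * t) +
      b * ∫ r in (0 : ℝ)..t, y r * semicircleMgf σ (2 * t - 2 * r) := by
  have h := response_double (continuous_spikeResponse hσ lam) (continuous_semicircleMgf hσ)
    (fun t ht => spikeResponse_eq hσ hlam.ne' ht) ht
  unfold reducedCov signal
  rw [min_self, ← two_mul t]
  linear_combination ρ ^ 2 * h

section Factoring

variable {σ lam ρ β : ℝ} {ν : Measure (ℝ × ℝ)} {R g : ℝ → ℝ} {K : ℝ → ℝ → ℝ}

theorem rhs_response (hν : IsInitialLaw lam ρ ν) (hlam : 0 < lam) (hg0 : g 0 = 1)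
    (hdec : ∀ r t, 0 ≤ r → 0 ≤ t → decay (fun x => x ^ 2 / 2) K r t = g t / g r)
    {t : ℝ} (ht : 0 ≤ t) :
    decay (fun x => x ^ 2 / 2) K 0 t *
        (∫ p, Real.exp (p.2 * t) * p.1.2 * p.1.1 ∂limitLaw ν (semicircle σ)) +
      ∫ s in (0 : ℝ)..t, decay (fun x => x ^ 2 / 2) K s t * R s *
        (∫ p, Real.exp (p.2 * (t - s)) * p.1.1 ^ 2 ∂limitLaw ν (semicircle σ)) =
    g t * (ρ * √lam * semicircleMgf σ t +
      lam * vconv (fun s => R s / g s) (semicircleMgf σ) t) := by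
  simp only [integral_limitLaw_cross hν, integral_limitLaw_sq_fst hν hlam]
  rw [hdec 0 t le_rfl ht, hg0, div_one, mul_add, vconv, ← intervalIntegral.integral_const_mul,
    ← intervalIntegral.integral_const_mul]
  congr 1
  refine intervalIntegral.integral_congr fun s hs => ?_
  rw [Set.uIcc_of_le ht] at hs
  simp only [hdec s t hs.1 ht]
  ring

/-- The quotients `g t / g r` and the factor `g r` hidden in each `R r` cancel, except in the noise
term, which keeps `1/g²`. The solution property is not assumed here, so the identity serves both
uniqueness and existence. -/
theorem rhs_covariance (hν : IsInitialLaw lam ρ ν) (hlam : 0 < lam)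
    (hg : ∀ t, 0 < g t) (hg0 : g 0 = 1)
    (hdec : ∀ r t, 0 ≤ r → 0 ≤ t → decay (fun x => x ^ 2 / 2) K r t = g t / g r)
    (hR : ∀ t, 0 ≤ t → R t = ρ * √lam * spikeResponse σ lam t * g t)
    {t s : ℝ} (ht : 0 ≤ t) (hs : 0 ≤ s) :
    β⁻¹ * (∫ r in (0 : ℝ)..(min s t),
        decay (fun x => x ^ 2 / 2) K r t * decay (fun x => x ^ 2 / 2) K r s *
          (∫ p, Real.exp (p.2 * (t + s - 2 * r)) ∂limitLaw ν (semicircle σ)))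
      + decay (fun x => x ^ 2 / 2) K 0 t * decay (fun x => x ^ 2 / 2) K 0 s *
        (∫ p, Real.exp (p.2 * (t + s)) * p.1.2 ^ 2 ∂limitLaw ν (semicircle σ))
      + decay (fun x => x ^ 2 / 2) K 0 t * (∫ r in (0 : ℝ)..s,
          decay (fun x => x ^ 2 / 2) K r s * R r *
          (∫ p, Real.exp (p.2 * (t + s - r)) * p.1.2 * p.1.1 ∂limitLaw ν (semicircle σ)))
      + decay (fun x => x ^ 2 / 2) K 0 s * (∫ r in (0 : ℝ)..t,
          decay (fun x => x ^ 2 / 2) K r t * R r *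
          (∫ p, Real.exp (p.2 * (t + s - r)) * p.1.2 * p.1.1 ∂limitLaw ν (semicircle σ)))
      + ∫ r₁ in (0 : ℝ)..t, ∫ r₂ in (0 : ℝ)..s,
          decay (fun x => x ^ 2 / 2) K r₁ t * decay (fun x => x ^ 2 / 2) K r₂ s * R r₁ * R r₂ *
            (∫ p, Real.exp (p.2 * (t + s - r₁ - r₂)) * p.1.1 ^ 2 ∂limitLaw ν (semicircle σ)) =
    g t * g s * reducedCov σ lam β⁻¹ ρ (fun r => (g r ^ 2)⁻¹) t s := by
  simp only [integral_limitLaw_cross hν, integral_limitLaw_sq_fst hν hlam,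
    integral_limitLaw_exp hν, integral_limitLaw_sq_snd hν]
  have hsq : √lam * √lam = lam := Real.mul_self_sqrt hlam.le
  have hgne : ∀ t, g t ≠ 0 := fun t => (hg t).ne'
  have i1 : ∫ r in (0 : ℝ)..(min s t), decay (fun x => x ^ 2 / 2) K r t *
      decay (fun x => x ^ 2 / 2) K r s * semicircleMgf σ (t + s - 2 * r) =
      g t * g s * ∫ r in (0 : ℝ)..(min s t), (g r ^ 2)⁻¹ * semicircleMgf σ (t + s - 2 * r) := by
    rw [← intervalIntegral.integral_const_mul]
    refine intervalIntegral.integral_congr fun r hr => ?_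
    rw [Set.uIcc_of_le (le_min hs ht)] at hr
    simp only [hdec r t hr.1 ht, hdec r s hr.1 hs]
    have := hgne r
    field_simp
  have i2 : ∀ u, 0 ≤ u → ∫ r in (0 : ℝ)..u, decay (fun x => x ^ 2 / 2) K r u * R r *
      (ρ * √lam * semicircleMgf σ (t + s - r)) =
      g u * (ρ ^ 2 * lam *
        ∫ r in (0 : ℝ)..u, spikeResponse σ lam r * semicircleMgf σ (t + s - r)) := by
    intro u hu
    rw [← intervalIntegral.integral_const_mul, ← intervalIntegral.integral_const_mul]
    refine intervalIntegral.integral_congr fun r hr => ?_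
    rw [Set.uIcc_of_le hu] at hr
    simp only [hdec r u hr.1 hu, hR r hr.1]
    have := hgne r
    field_simp
    linear_combination (g u * ρ ^ 2 * spikeResponse σ lam r * semicircleMgf σ (t + s - r)) * hsq
  have i3 : ∫ r₁ in (0 : ℝ)..t, ∫ r₂ in (0 : ℝ)..s, decay (fun x => x ^ 2 / 2) K r₁ t *
      decay (fun x => x ^ 2 / 2) K r₂ s * R r₁ * R r₂ *
        (lam * semicircleMgf σ (t + s - r₁ - r₂)) =
      g t * g s * (ρ ^ 2 * lam ^ 2 * ∫ r₁ in (0 : ℝ)..t, ∫ r₂ in (0 : ℝ)..s,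
        spikeResponse σ lam r₁ * spikeResponse σ lam r₂ *
          semicircleMgf σ (t + s - r₁ - r₂)) := by
    rw [← intervalIntegral.integral_const_mul, ← intervalIntegral.integral_const_mul]
    refine intervalIntegral.integral_congr fun r₁ hr₁ => ?_
    rw [← intervalIntegral.integral_const_mul, ← intervalIntegral.integral_const_mul]
    refine intervalIntegral.integral_congr fun r₂ hr₂ => ?_
    rw [Set.uIcc_of_le ht] at hr₁
    rw [Set.uIcc_of_le hs] at hr₂
    simp only [hdec r₁ t hr₁.1 ht, hdec r₂ s hr₂.1 hs, hR r₁ hr₁.1, hR r₂ hr₂.1]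
    have := hgne r₁
    have := hgne r₂
    field_simp
    linear_combination (g t * g s * ρ ^ 2 * spikeResponse σ lam r₁ * spikeResponse σ lam r₂ *
      semicircleMgf σ (t + s - r₁ - r₂)) * hsq
  rw [i1, i2 s hs, i2 t ht, i3, hdec 0 t le_rfl ht, hdec 0 s le_rfl hs, hg0]
  unfold reducedCov
  ring

end Factoring

/-! ### The solution of the system in closed form. -/

theorem vconv_two_mul (f g : ℝ → ℝ) (t : ℝ) :
    vconv f g (2 * t) = 2 * ∫ r in (0 : ℝ)..t, f (2 * r) * g (2 * t - 2 * r) := by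
  have := intervalIntegral.integral_comp_mul_left (a := 0) (b := t)
    (fun x => f x * g (2 * t - x)) (two_ne_zero (α := ℝ))
  rw [this, mul_zero, smul_eq_mul, vconv]
  ring

theorem reducedCov_congr {σ lam b ρ : ℝ} {y y' : ℝ → ℝ} (h : ∀ r, 0 ≤ r → y r = y' r) {t s : ℝ}
    (ht : 0 ≤ t) (hs : 0 ≤ s) : reducedCov σ lam b ρ y t s = reducedCov σ lam b ρ y' t s := by
  have : ∫ r in (0 : ℝ)..(min s t), y r * semicircleMgf σ (t + s - 2 * r) =
      ∫ r in (0 : ℝ)..(min s t), y' r * semicircleMgf σ (t + s - 2 * r) := by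
    refine intervalIntegral.integral_congr fun r hr => ?_
    rw [Set.uIcc_of_le (le_min hs ht)] at hr
    simp only [h r hr.1]
  unfold reducedCov
  rw [this]

/-- The decay `exp (-∫₀ᵗ K(w, w) dw)` of the solution, expressed through the energy. -/
noncomputable def canonicalDecay (p : ℝ → ℝ) (t : ℝ) : ℝ := (√(growth p (2 * t)))⁻¹

/-- The response of the system, in closed form. -/
noncomputable def canonicalR (σ lam ρ : ℝ) (p : ℝ → ℝ) (t : ℝ) : ℝ :=
  ρ * √lam * spikeResponse σ lam t * canonicalDecay p t

/-- The covariance of the system, in terms of the energy. -/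
noncomputable def canonicalK (σ lam b ρ : ℝ) (p : ℝ → ℝ) (t s : ℝ) : ℝ :=
  canonicalDecay p t * canonicalDecay p s *
    reducedCov σ lam b ρ (fun r => growth p (2 * r)) t s

theorem canonicalK_diag {σ lam b ρ : ℝ} {p : ℝ → ℝ} (hσ : 0 < σ) (hlam : 0 < lam)
    (hp : IsEnergy σ lam b ρ p) {t : ℝ} (ht : 0 ≤ t) :
    canonicalK σ lam b ρ p t t = canonicalDecay p t ^ 2 * p (2 * t) := by
  rw [canonicalK, reducedCov_diag b ρ hσ hlam _ ht, hp.eq_growth hσ (by linarith), vconv_comm,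
    vconv_two_mul]
  ring

section Solution

variable {σ lam ρ β : ℝ} {ν : Measure (ℝ × ℝ)} {p : ℝ → ℝ}

/-- Every solution of the system is the canonical one. -/
theorem IsSolution.eq_canonical (hσ : 0 < σ) (hlam : 0 < lam) (hν : IsInitialLaw lam ρ ν)
    (hp : IsEnergy σ lam β⁻¹ ρ p) {R : ℝ → ℝ} {K : ℝ → ℝ → ℝ}
    (h : IsSolution (fun x => x ^ 2 / 2) β (limitLaw ν (semicircle σ)) R K) :
    (∀ t, 0 ≤ t → R t = canonicalR σ lam ρ p t) ∧
      ∀ t s, 0 ≤ t → 0 ≤ s → K t s = canonicalK σ lam β⁻¹ ρ p t s := by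
  have hm := continuous_semicircleMgf hσ
  have hh := continuous_spikeResponse hσ lam
  -- The absolute value extends the diagonal, continuous only on the half-line, to a continuous
  -- function on `ℝ`.
  set A : ℝ → ℝ := fun w => K |w| |w| with hA_def
  have hA : Continuous A :=
    h.continuousOn_K.comp_continuous (f := fun w : ℝ => (|w|, |w|)) (by fun_prop)
      fun w => ⟨abs_nonneg w, abs_nonneg w⟩
  have hKA : ∀ w, 0 ≤ w → K w w = A w := fun w hw => by simp only [hA_def, abs_of_nonneg hw]
  set g : ℝ → ℝ := fun t => Real.exp (-∫ w in (0 : ℝ)..t, A w) with hg_def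
  have hg : ∀ t, 0 < g t := fun t => Real.exp_pos _
  have hg0 : g 0 = 1 := by simp [hg_def]
  have hdec : ∀ r t, 0 ≤ r → 0 ≤ t → decay (fun x => x ^ 2 / 2) K r t = g t / g r :=
    fun r t hr ht => decay_eq_div hA hKA hr ht
  have hprim : ∀ t, HasDerivAt (fun t => ∫ w in (0 : ℝ)..t, A w) (A t) t := fun t =>
    intervalIntegral.integral_hasDerivAt_right (hA.intervalIntegrable _ _)
      (hA.stronglyMeasurableAtFilter _ _) hA.continuousAt
  have hgd : ∀ t, HasDerivAt g (g t * -A t) t := fun t => (hprim t).neg.exp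
  have hgc : Continuous g := continuous_iff_continuousAt.2 fun t => (hgd t).continuousAt
  have hRc : Continuous fun t => R |t| / g t :=
    (h.continuousOn_R.comp_continuous continuous_abs fun t => abs_nonneg t).div hgc
      fun t => (hg t).ne'
  have hR : ∀ t, 0 ≤ t → R t = ρ * √lam * spikeResponse σ lam t * g t := by
    intro t ht
    -- Both `R/g` and the multiple of `spikeResponse` solve the Volterra equation with kernel `lam
    -- m` and forcing `ρ√lam m`.
    have := volterra_unique (F := fun t => ρ * √lam * semicircleMgf σ t)
      (k := fun t => lam * semicircleMgf σ t) (x := fun t => R |t| / g t)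
      (y := fun t => ρ * √lam * spikeResponse σ lam t) (hm.const_mul _) hRc (hh.const_mul _)
      (fun t ht => by
        have e := h.eq_R t ht
        rw [rhs_response hν hlam hg0 hdec ht] at e
        simp only [abs_of_nonneg ht]
        rw [e, mul_div_cancel_left₀ _ (hg t).ne', vconv_const_mul_left, vconv_comm _ (semicircleMgf σ)]
        congr 2
        exact vconv_congr ht (fun _ _ _ => rfl) fun x hx _ => by rw [abs_of_nonneg hx])
      (fun t ht => by
        rw [vconv_const_mul_left, vconv_const_mul_right, spikeResponse_eq hσ hlam.ne' ht]
        ring) t ht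
    simp only [abs_of_nonneg ht] at this
    rwa [div_eq_iff (hg t).ne'] at this
  have hK : ∀ t s, 0 ≤ t → 0 ≤ s →
      K t s = g t * g s * reducedCov σ lam β⁻¹ ρ (fun r => (g r ^ 2)⁻¹) t s :=
    fun t s ht hs => (h.eq_K t s ht hs).trans (rhs_covariance hν hlam hg hg0 hdec hR ht hs)
  set y : ℝ → ℝ := fun r => (g r ^ 2)⁻¹ with hy_def
  have hyd : ∀ t, HasDerivAt y (2 * A t * y t) t := fun t => by
    have hne := (hg t).ne'
    convert! ((hgd t).pow 2).inv (pow_ne_zero 2 hne) using 1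
    simp only [hy_def, Pi.pow_apply]
    field_simp
    push_cast
    ring
  have hyc : Continuous y := continuous_iff_continuousAt.2 fun t => (hyd t).continuousAt
  -- The diagonal involves `m` at doubled times, hence the variable `τ = 2t`. Halving time also
  -- absorbs the factor `2` in `y' = 2 A y`, so that `τ ↦ y(τ/2)` has derivative exactly the energy.
  have hen : IsEnergy σ lam β⁻¹ ρ fun τ => A (τ / 2) * y (τ / 2) := by
    have hpc : Continuous fun τ => A (τ / 2) * y (τ / 2) := by fun_prop
    refine isEnergy_of_eq (Y := fun τ => y (τ / 2)) hσ hpc (fun τ hτ => ?_) fun τ hτ => ?_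
    · rw [vconv_one_left, intervalIntegral.integral_eq_sub_of_hasDerivAt
        (f := fun τ => y (τ / 2)) (fun x _ => ?_) (hpc.intervalIntegrable _ _)]
      · simp [hy_def, hg0]
      · have := (hyd (x / 2)).comp x ((hasDerivAt_id x).div_const 2)
        convert! this using 1
        ring
    · have e := hK (τ / 2) (τ / 2) (by linarith) (by linarith)
      rw [reducedCov_diag _ _ hσ hlam _ (by linarith), hKA _ (by linarith)] at e
      have e2 := vconv_two_mul (fun τ => y (τ / 2)) (semicircleMgf σ) (τ / 2)
      have e3 : 2 * (τ / 2) = τ := by ring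
      simp only [e3, mul_div_cancel_left₀ _ (two_ne_zero (α := ℝ))] at e e2
      rw [vconv_comm, e2, e]
      have hne := (hg (τ / 2)).ne'
      simp only [hy_def]
      field_simp
  have hyg : ∀ t, 0 ≤ t → y t = growth p (2 * t) := by
    intro t ht
    have h2t : 0 ≤ 2 * t := by linarith
    have e1 : growth (fun τ => A (τ / 2) * y (τ / 2)) (2 * t) = growth p (2 * t) := by
      rw [growth_eq h2t, growth_eq h2t]
      congr 1
      exact vconv_congr h2t (fun _ _ _ => rfl) fun x hx _ => hen.unique hσ hp x hx
    rw [← e1, growth_eq h2t, vconv_one_left, intervalIntegral.integral_eq_sub_of_hasDerivAt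
        (f := fun τ => y (τ / 2)) (fun x _ => ?_) (hen.continuous.intervalIntegrable _ _)]
    · simp [hy_def, hg0]
    · have := (hyd (x / 2)).comp x ((hasDerivAt_id x).div_const 2)
      convert! this using 1
      ring
  have hgg : ∀ t, 0 ≤ t → g t = canonicalDecay p t := by
    intro t ht
    rw [canonicalDecay, ← hyg t ht, hy_def, Real.sqrt_inv, Real.sqrt_sq (hg t).le, inv_inv]
  refine ⟨fun t ht => ?_, fun t s ht hs => ?_⟩
  · rw [hR t ht, hgg t ht]; rfl
  · rw [hK t s ht hs, hgg t ht, hgg s hs, reducedCov_congr hyg ht hs]; rfl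

/-- The point is self-consistency: the decay computed from the diagonal of `canonicalK` must be
`canonicalDecay`. The equations then follow from the factored forms. -/
theorem isSolution_canonical (hσ : 0 < σ) (hlam : σ / 2 < lam) (hβ : 0 < β)
    (hρ : ρ ∈ Set.Icc (0 : ℝ) 1) (hν : IsInitialLaw lam ρ ν) (hp : IsEnergy σ lam β⁻¹ ρ p) :
    IsSolution (fun x => x ^ 2 / 2) β (limitLaw ν (semicircle σ)) (canonicalR σ lam ρ p)
      (canonicalK σ lam β⁻¹ ρ p) := by
  have hlam0 : 0 < lam := by linarith
  have hm := continuous_semicircleMgf hσ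
  have hh := continuous_spikeResponse hσ lam
  have hpc := hp.continuous
  have hY := continuous_growth hpc
  have hpos : ∀ t, 0 < growth p t := fun t => zero_lt_one.trans_le
    (one_le_growth (fun t ht => (hp.pos hσ hlam (inv_pos.2 hβ) hρ ht).le) t)
  have hg : ∀ t, 0 < canonicalDecay p t := fun t => inv_pos.2 (Real.sqrt_pos.2 (hpos _))
  have hgc : Continuous (canonicalDecay p) := by
    unfold canonicalDecay
    exact (by fun_prop : Continuous fun t => √(growth p (2 * t))).inv₀
      fun t => (Real.sqrt_pos.2 (hpos _)).ne'
  have hg2 : ∀ t, (canonicalDecay p t ^ 2)⁻¹ = growth p (2 * t) := fun t => by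
    rw [canonicalDecay, inv_pow, inv_inv, Real.sq_sqrt (hpos _).le]
  set A : ℝ → ℝ := fun w => canonicalDecay p w ^ 2 * p (2 * w) with hA_def
  have hA : Continuous A := by fun_prop
  have hprim : ∀ t, 0 ≤ t → Real.exp (-∫ w in (0 : ℝ)..t, A w) = canonicalDecay p t := by
    intro t ht
    -- Here `A(w) = p(2w)/growth p (2w)` is the derivative of half the logarithm of `growth p (2w)`.
    have hlog : ∫ w in (0 : ℝ)..t, A w =
        Real.log (growth p (2 * t)) / 2 - Real.log (growth p (2 * 0)) / 2 := by
      refine intervalIntegral.integral_eq_sub_of_hasDerivAt_of_le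
        (f := fun t => Real.log (growth p (2 * t)) / 2) ht ?_ ?_ (hA.intervalIntegrable _ _)
      · exact (((hY.comp (continuous_const_mul 2)).log fun t => (hpos _).ne').div_const
          2).continuousOn
      · intro x hx
        have h1 : HasDerivAt (growth p) (p (2 * x)) (2 * x) := by
          refine ((hasDerivAt_vconv_one hpc (2 * x)).const_add 1).congr_of_eventuallyEq ?_
          filter_upwards [lt_mem_nhds (show 0 < 2 * x by linarith [hx.1])] with u hu
          exact growth_eq hu.le
        have h2 := ((h1.comp x ((hasDerivAt_id x).const_mul 2)).log (hpos _).ne').div_const 2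
        convert! h2 using 1
        simp only [hA_def, Function.comp, ← hg2 x]
        have := (hg x).ne'
        field_simp
    have h0 : growth p (2 * 0) = 1 := by simp [growth]
    rw [hlog, h0, Real.log_one, zero_div, sub_zero, Real.exp_neg, canonicalDecay,
      ← Real.log_sqrt (hpos _).le, Real.exp_log (Real.sqrt_pos.2 (hpos _))]
  have hdec : ∀ r t, 0 ≤ r → 0 ≤ t →
      decay (fun x => x ^ 2 / 2) (canonicalK σ lam β⁻¹ ρ p) r t =
        canonicalDecay p t / canonicalDecay p r := by
    intro r t hr ht
    rw [decay_eq_div hA (fun w hw => canonicalK_diag hσ hlam0 hp hw) hr ht, hprim t ht, hprim r hr]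
  have hg0 : canonicalDecay p 0 = 1 := by simp [canonicalDecay, growth]
  refine ⟨?_, ?_, fun t ht => ?_, fun t s ht hs => ?_⟩
  · exact Continuous.continuousOn ((hh.const_mul _).mul hgc)
  · exact Continuous.continuousOn (((hgc.comp continuous_fst).mul (hgc.comp continuous_snd)).mul
      (continuous_reducedCov hσ lam β⁻¹ ρ (y := fun r => growth p (2 * r)) (by fun_prop)))
  · rw [rhs_response hν hlam0 hg0 hdec ht,
      vconv_congr ht (f' := fun s => ρ * √lam * spikeResponse σ lam s) (g' := semicircleMgf σ)
        (fun x _ _ => by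
        rw [canonicalR, mul_div_cancel_right₀ _ (hg x).ne']) (fun _ _ _ => rfl),
      vconv_const_mul_left, vconv_comm, canonicalR, spikeResponse_eq hσ hlam0.ne' ht]
    ring
  · have e := rhs_covariance (β := β) hν hlam0 hg hg0 hdec (R := canonicalR σ lam ρ p)
      (fun t _ => rfl) ht hs
    simp only [hg2] at e
    exact e.symm

theorem overlap_eq (hσ : 0 < σ) (hlam : σ / 2 < lam) (hβ : 0 < β)
    (hρ : ρ ∈ Set.Icc (0 : ℝ) 1) (hν : IsInitialLaw lam ρ ν) (hp : IsEnergy σ lam β⁻¹ ρ p)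
    {R : ℝ → ℝ} {K : ℝ → ℝ → ℝ}
    (h : IsSolution (fun x => x ^ 2 / 2) β (limitLaw ν (semicircle σ)) R K) {t : ℝ} (ht : 0 ≤ t) :
    0 < K t t ∧ R t ^ 2 / (lam * K t t) = ρ ^ 2 * spikeResponse σ lam t ^ 2 / p (2 * t) := by
  have hlam0 : 0 < lam := by linarith
  obtain ⟨hR, hK⟩ := h.eq_canonical hσ hlam0 hν hp
  have hpp := hp.pos hσ hlam (inv_pos.2 hβ) hρ (t := 2 * t) (by linarith)
  have hg : 0 < canonicalDecay p t := inv_pos.2 (Real.sqrt_pos.2 (zero_lt_one.trans_le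
    (one_le_growth (fun t ht => (hp.pos hσ hlam (inv_pos.2 hβ) hρ ht).le) _)))
  rw [hK t t ht ht, hR t ht, canonicalK_diag hσ hlam0 hp ht, canonicalR]
  refine ⟨by positivity, ?_⟩
  have hsq : √lam ^ 2 = lam := Real.sq_sqrt hlam0.le
  simp only [mul_pow, hsq]
  field_simp

end Solution

/-! ### Asymptotics of the overlap. -/

/-- The overlap vanishes when the outlier of the noise dominates. -/
theorem tendsto_overlap_zero {σ lam ρ β : ℝ} {p : ℝ → ℝ} (hσ : 0 < σ) (hlam : σ / 2 < lam)
    (hβ : 0 < β) (hρ : ρ ∈ Set.Icc (0 : ℝ) 1) (hp : IsEnergy σ lam β⁻¹ ρ p)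
    (h : 2 * outlier σ lam < threshold β σ) :
    Tendsto (fun t => ρ ^ 2 * spikeResponse σ lam t ^ 2 / p (2 * t)) atTop (𝓝 0) := by
  obtain ⟨α, hα, hbα, hlt⟩ := noise_of_lt_threshold hσ hlam hβ h
  have hb : 0 < β⁻¹ := inv_pos.2 hβ
  set c := β⁻¹ / 4 * (1 - σ ^ 2 / (4 * α ^ 2)) with hc_def
  have hc : 0 < c := mul_pos (by positivity) (spikeWeight_pos hσ hα)
  -- The numerator grows at rate `2 · outlier σ lam` and `p(2t)` at least at rate `2 · outlier σ α`.
  -- The factor `exp (outlier σ α)` pays for the unit time shift in `IsEnergy.le`.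
  have hlim := (tendsto_exp_neg_mul (z := 2 * (outlier σ α - outlier σ lam))
    (by linarith)).const_mul (ρ ^ 2 * Real.exp (outlier σ α) / c)
  rw [mul_zero] at hlim
  refine squeeze_zero' ((eventually_ge_atTop 0).mono fun t ht => ?_)
    ((eventually_ge_atTop 1).mono fun t ht => ?_) hlim
  · have := hp.pos hσ hlam hb hρ (t := 2 * t) (by linarith)
    positivity
  · have h1 := hp.le hσ hlam hρ hα hbα (t := 2 * t) (by linarith)
    have h2 := spikeResponse_le hσ hlam (t := t) (by linarith)
    have h3 := (spikeResponse_pos hσ hlam (t := t) (by linarith)).le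
    have h4 : 0 < c * Real.exp (outlier σ α * (2 * t - 1)) := mul_pos hc (Real.exp_pos _)
    calc ρ ^ 2 * spikeResponse σ lam t ^ 2 / p (2 * t)
        ≤ ρ ^ 2 * Real.exp (outlier σ lam * t) ^ 2 / (c * Real.exp (outlier σ α * (2 * t - 1))) := by
          gcongr
      _ = ρ ^ 2 / c * (Real.exp (outlier σ lam * t) ^ 2 *
            (Real.exp (outlier σ α * (2 * t - 1)))⁻¹) := by field_simp
      _ = ρ ^ 2 / c * (Real.exp (outlier σ α) *
            Real.exp (-(2 * (outlier σ α - outlier σ lam)) * t)) := by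
          rw [← Real.exp_neg, ← Real.exp_nat_mul, ← Real.exp_add, ← Real.exp_add]
          congr 2
          push_cast; ring
      _ = _ := by ring

/-- The overlap has a positive limit when the outlier of the signal dominates. -/
theorem tendsto_overlap {σ lam ρ β : ℝ} {p : ℝ → ℝ} (hσ : 0 < σ) (hlam : σ / 2 < lam)
    (hβ : 0 < β) (hρ : ρ ∈ Set.Icc (0 : ℝ) 1) (hρ0 : 0 < ρ) (hp : IsEnergy σ lam β⁻¹ ρ p)
    (h : threshold β σ < 2 * outlier σ lam) :
    Tendsto (fun t => ρ ^ 2 * spikeResponse σ lam t ^ 2 / p (2 * t)) atTop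
      (𝓝 ((1 - β⁻¹ / (2 * lam * outlier σ lam)) * (1 - σ ^ 2 / (4 * lam ^ 2)))) := by
  have hlam0 : 0 < lam := by linarith
  have hz0 := hσ.trans (lt_outlier hσ hlam)
  have hbl := noise_lt_of_threshold_lt hσ hlam hβ h
  have hn : 0 < 1 - β⁻¹ / (2 * lam * outlier σ lam) := by
    rwa [sub_pos, div_lt_one (by positivity)]
  have hc := spikeWeight_pos hσ hlam
  have h1 := ((tendsto_exp_mul_spikeResponse hσ hlam).pow 2).const_mul (ρ ^ 2)
  have h2 := (hp.tendsto hσ hlam (inv_pos.2 hβ) hρ hbl).comp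
    (tendsto_id.const_mul_atTop (two_pos (α := ℝ)))
  -- The limit of the denominator is nonzero only because `ρ > 0`; one factor `ρ² (1 - σ²/(4 lam²))`
  -- then cancels.
  have h3 := h1.div h2 (by positivity)
  generalize 1 - β⁻¹ / (2 * lam * outlier σ lam) = n at hn h3 ⊢
  generalize 1 - σ ^ 2 / (4 * lam ^ 2) = c at hc h3 ⊢
  have e : ρ ^ 2 * c ^ 2 / (ρ ^ 2 * c / n) = n * c := by field_simp
  rw [e] at h3
  refine h3.congr fun t => ?_
  have e2 : Real.exp (-outlier σ lam * (2 * t)) = Real.exp (-outlier σ lam * t) ^ 2 := by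
    rw [← Real.exp_nat_mul]; congr 1; push_cast; ring
  have := Real.exp_pos (-outlier σ lam * t)
  simp only [Function.comp, id, e2, Pi.div_apply, mul_pow]
  rw [mul_left_comm, mul_div_mul_left _ _ (by positivity)]

end CHSCK

theorem theorem2 (σ lam β ρ : ℝ) (hσ : 0 < σ) (hlam : σ / 2 < lam) (hβ : 0 < β)
    (hρ : ρ ∈ Set.Icc (0 : ℝ) 1) (ν : Measure (ℝ × ℝ)) (hν : CHSCK.IsInitialLaw lam ρ ν) :
    -- roots of `z = β⁻¹ S(z / 2)`, and `s_β` is the largest one if there is one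
    ((CHSCK.roots β σ).Nonempty ↔ β < 1 / σ ^ 2) ∧
    (β < 1 / σ ^ 2 →
      (CHSCK.roots β σ).ncard = 2 ∧
        IsGreatest (CHSCK.roots β σ) (CHSCK.threshold β σ)) ∧
    -- the system determines `R` and `K`
    (∃ R K, CHSCK.IsSolution (fun x => x ^ 2 / 2) β
      (CHSCK.limitLaw ν (CHSCK.semicircle σ)) R K) ∧
    (∀ R K R' K',
      CHSCK.IsSolution (fun x => x ^ 2 / 2) β
        (CHSCK.limitLaw ν (CHSCK.semicircle σ)) R K →
      CHSCK.IsSolution (fun x => x ^ 2 / 2) β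
        (CHSCK.limitLaw ν (CHSCK.semicircle σ)) R' K' →
      (∀ t : ℝ, 0 ≤ t → R t = R' t) ∧
        ∀ t s : ℝ, 0 ≤ t → 0 ≤ s → K t s = K' t s) ∧
    -- the limiting correlation
    (∀ R K,
      CHSCK.IsSolution (fun x => x ^ 2 / 2) β
        (CHSCK.limitLaw ν (CHSCK.semicircle σ)) R K →
      (∀ t : ℝ, 0 ≤ t → 0 < K t t) ∧
      ((2 * (lam + σ ^ 2 / (4 * lam)) < CHSCK.threshold β σ ∨ ρ = 0) →
        Tendsto (fun t : ℝ => R t ^ 2 / (lam * K t t)) atTop (𝓝 0)) ∧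
      ((CHSCK.threshold β σ < 2 * (lam + σ ^ 2 / (4 * lam)) ∧ 0 < ρ) →
        Tendsto (fun t : ℝ => R t ^ 2 / (lam * K t t)) atTop
          (𝓝 ((1 - β⁻¹ / (2 * lam * (lam + σ ^ 2 / (4 * lam)))) *
            (1 - σ ^ 2 / (4 * lam ^ 2)))))) := by
  have hlam0 : 0 < lam := by linarith
  obtain ⟨p, hp⟩ := CHSCK.exists_isEnergy hσ hlam (inv_pos.2 hβ) hρ
  refine ⟨⟨fun hne => ?_, fun h => ⟨_, (CHSCK.isGreatest_roots hσ hβ h).1⟩⟩, fun h =>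
    ⟨CHSCK.ncard_roots hσ hβ h, ?_⟩,
    ⟨_, _, CHSCK.isSolution_canonical hσ hlam hβ hρ hν hp⟩, fun R K R' K' h h' => ?_,
    fun R K h => ⟨fun t ht => (CHSCK.overlap_eq hσ hlam hβ hρ hν hp h ht).1, ?_, ?_⟩⟩
  · by_contra hc
    rw [CHSCK.roots_eq_empty hσ hβ hc] at hne
    exact Set.not_nonempty_empty hne
  · rw [CHSCK.threshold_eq hσ hβ h]
    exact CHSCK.isGreatest_roots hσ hβ h
  · obtain ⟨hR, hK⟩ := h.eq_canonical hσ hlam0 hν hp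
    obtain ⟨hR', hK'⟩ := h'.eq_canonical hσ hlam0 hν hp
    exact ⟨fun t ht => (hR t ht).trans (hR' t ht).symm,
      fun t s ht hs => (hK t s ht hs).trans (hK' t s ht hs).symm⟩
  · intro hcase
    have heq : (fun t => ρ ^ 2 * CHSCK.spikeResponse σ lam t ^ 2 / p (2 * t)) =ᶠ[atTop]
        fun t => R t ^ 2 / (lam * K t t) := (eventually_ge_atTop 0).mono fun t ht =>
      (CHSCK.overlap_eq hσ hlam hβ hρ hν hp h ht).2.symm
    rcases hcase with hlt | rfl
    · exact (CHSCK.tendsto_overlap_zero hσ hlam hβ hρ hp hlt).congr' heq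
    -- For `ρ = 0` the overlap is identically zero, whatever the growth rates.
    · refine Tendsto.congr' heq ?_
      simp
  · rintro ⟨hlt, hρ0⟩
    exact (CHSCK.tendsto_overlap hσ hlam hβ hρ hρ0 hp hlt).congr'
      ((eventually_ge_atTop 0).mono fun t ht =>
        (CHSCK.overlap_eq hσ hlam hβ hρ hν hp h ht).2.symm)
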